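/- Let $0<r<a$ and let $T$ be the torus in $\mathbb R^3$ parametrized by $X(u,v)=((a+r\cos u)\cos v,\,(a+r\cos u)\sin v,\,r\sin u)$, $2\pi$-periodic in $u$ and $v$. For $n\ge 1$ and real coefficients $\alpha_k$ ($0\le k\le n$), $\beta_{m,k}$ ($1\le m\le[n/2]$, $1\le k\le n-2m$) put $$\mathcal E^K_n(H,K)=\sum_{k=0}^{n}\alpha_k H^k+\sum_{m=1}^{[n/2]}K^m\sum_{k=1}^{n-2m}\beta_{m,k}H^k ,\qquad \mathcal F^K_n(S)=\int_S\mathcal E^K_n(H,K)\,dA+p\int_V dV ,$$ where $H$ and $K$ are the mean and the Gaussian curvature of the closed surface $S$ (taken with respect to the unit normal $N=X_u\times X_v/|X_u\times X_v|$), $V$ is the region enclosed by $S$ and $p$ is a real constant. The torus is a critical point of $\mathcal F^K_n$ if $\frac{d}{dt}\big|_{t=0}\mathcal F^K_n(X+t\,\Omega N)$ exists and equals $0$ for every smooth function $\Omega$ on $T$. (1) Let $n=1$ or $n\ge 3$, and if $n=3$ assume $a^2\ne 2r^2$. Then, with no other restriction on the radii, for every prescribed leading coefficient $\alpha_n\in\mathbb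 R$ (in particular for every $\alpha_n\neq 0$) there are remaining coefficients $\alpha_k$ ($k<n$), $\beta_{m,k}$ and a constant $p$ such that $T$ is a critical point of $\mathcal F^K_n$. (2) Let $n\ge 3$ and $a^2\ne 2r^2$. Then for every choice of the coefficients $\alpha_k$ ($k\ne 0,2$) and $\beta_{m,k}$ ($m\ge 2$) there are values of the $n+1$ unknowns $p$, $\alpha_0$, $\alpha_2$, $\beta_{1,k}$ ($1\le k\le n-2$) such that $T$ is a critical point of $\mathcal F^K_n$. -/

import Mathlib

open scoped ContDiff Matrix

noncomputable section

namespace TorusCritical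

/-- A closed surface of torus type is given by a map `X (u, v)` that is `2π`-periodic in both
parameters; vectors of `ℝ³` are coordinate triples, with the dot product `⬝ᵥ` and the cross
product `⨯₃`. -/
abbrev ParamSurface := ℝ → ℝ → (Fin 3 → ℝ)

/-- The partial derivative `X_u`. -/
def partialU (X : ParamSurface) : ParamSurface :=
  fun u v => deriv (fun s => X s v) u

/-- The partial derivative `X_v`. -/
def partialV (X : ParamSurface) : ParamSurface :=
  fun u v => deriv (fun s => X u s) v

/-- First fundamental form. -/
def firstE (X : ParamSurface) (u v : ℝ) : ℝ := partialU X u v ⬝ᵥ partialU X u v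

def firstF (X : ParamSurface) (u v : ℝ) : ℝ := partialU X u v ⬝ᵥ partialV X u v

def firstG (X : ParamSurface) (u v : ℝ) : ℝ := partialV X u v ⬝ᵥ partialV X u v

/-- The determinant of the first fundamental form, which is `|X_u × X_v|²`. -/
def detFirst (X : ParamSurface) (u v : ℝ) : ℝ :=
  firstE X u v * firstG X u v - firstF X u v ^ 2

/-- The density of `dA` with respect to `du dv`. -/
def areaDensity (X : ParamSurface) (u v : ℝ) : ℝ := √(detFirst X u v)

/-- The unit normal `X_u × X_v / |X_u × X_v|`; it points inward on the torus below. -/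
def unitNormal (X : ParamSurface) : ParamSurface :=
  fun u v => (areaDensity X u v)⁻¹ • (partialU X u v ⨯₃ partialV X u v)

/-- Second fundamental form. -/
def secondL (X : ParamSurface) (u v : ℝ) : ℝ :=
  partialU (partialU X) u v ⬝ᵥ unitNormal X u v

def secondM (X : ParamSurface) (u v : ℝ) : ℝ :=
  partialV (partialU X) u v ⬝ᵥ unitNormal X u v

def secondN (X : ParamSurface) (u v : ℝ) : ℝ :=
  partialV (partialV X) u v ⬝ᵥ unitNormal X u v

/-- The mean curvature `H`, half the sum of the principal curvatures. -/
def meanCurvature (X : ParamSurface) (u v : ℝ) : ℝ :=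
  (firstE X u v * secondN X u v - 2 * (firstF X u v * secondM X u v)
    + firstG X u v * secondL X u v) / (2 * detFirst X u v)

/-- The Gaussian curvature `K`. -/
def gaussCurvature (X : ParamSurface) (u v : ℝ) : ℝ :=
  (secondL X u v * secondN X u v - secondM X u v ^ 2) / detFirst X u v

/-- The curvature energy `∫_S E(H, K) dA`. -/
def curvatureEnergy (E : ℝ → ℝ → ℝ) (X : ParamSurface) : ℝ :=
  ∫ u in (0 : ℝ)..(2 * Real.pi), ∫ v in (0 : ℝ)..(2 * Real.pi),
    E (meanCurvature X u v) (gaussCurvature X u v) * areaDensity X u v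

/-- The volume enclosed by the closed surface, as the flux `|(1/3) ∫_S ⟨X, N⟩ dA|` of the
position vector; the absolute value makes it independent of the orientation. -/
def enclosedVolume (X : ParamSurface) : ℝ :=
  |(1 / 3 : ℝ) * ∫ u in (0 : ℝ)..(2 * Real.pi), ∫ v in (0 : ℝ)..(2 * Real.pi),
    X u v ⬝ᵥ (partialU X u v ⨯₃ partialV X u v)|

/-- The functional `∫_S E(H, K) dA + p ∫_V dV`. -/
def shapeFunctional (E : ℝ → ℝ → ℝ) (p : ℝ) (X : ParamSurface) : ℝ :=
  curvatureEnergy E X + p * enclosedVolume X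

/-- Smooth functions on a surface of torus type: smooth and doubly `2π`-periodic in the
parameters. -/
def IsSmoothOnTorus (Ω : ℝ → ℝ → ℝ) : Prop :=
  ContDiff ℝ ∞ (fun q : ℝ × ℝ => Ω q.1 q.2) ∧
    (∀ u v, Ω (u + 2 * Real.pi) v = Ω u v) ∧ ∀ u v, Ω u (v + 2 * Real.pi) = Ω u v

/-- The normal variation `X + t Ω N`. -/
def normalVariation (X : ParamSurface) (Ω : ℝ → ℝ → ℝ) (t : ℝ) : ParamSurface :=
  fun u v => X u v + (t * Ω u v) • unitNormal X u v

/-- `X` is a critical point of `F`: for every smooth `Ω` on the surface, the first variation of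
`F` along `X + t Ω N` exists and is zero. -/
def IsCriticalPoint (F : ParamSurface → ℝ) (X : ParamSurface) : Prop :=
  ∀ Ω : ℝ → ℝ → ℝ, IsSmoothOnTorus Ω →
    HasDerivAt (fun t : ℝ => F (normalVariation X Ω t)) 0 0

/-- The torus of revolution with radii `a > r`. -/
def torus (a r : ℝ) : ParamSurface :=
  fun u v => ![(a + r * Real.cos u) * Real.cos v, (a + r * Real.cos u) * Real.sin v,
    r * Real.sin u]

/-- The Lagrange function
`∑_{k=0}^{n} α_k H^k + ∑_{m=1}^{[n/2]} K^m ∑_{k=1}^{n-2m} β_{m,k} H^k`. -/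
def lagrangeFunction (n : ℕ) (α : ℕ → ℝ) (β : ℕ → ℕ → ℝ) (H K : ℝ) : ℝ :=
  (∑ k ∈ Finset.range (n + 1), α k * H ^ k)
    + ∑ m ∈ Finset.Icc 1 (n / 2), K ^ m * (∑ k ∈ Finset.Icc 1 (n - 2 * m), β m k * H ^ k)

end TorusCritical

end

open scoped ContDiff Matrix

noncomputable section

namespace TorusCritical

/-! ### Calculus on the parameter square: differentiation under the integral and the divergence
theorem. -/

section

open MeasureTheory Set Filter Topology

/-! Criticality reduces to an identity between polynomials in one variable, which is then solved by
elimination.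

The normal `N` of the torus points to the core circle, so `X + tΩN` is the tube of variable radius
`r - tΩ`, and all curvatures are explicit in the 2-jet of that radius. Differentiating under the
integral and integrating by parts over one period in each variable, the first variation becomes the
integral of `r f Ω (EL - p)`, where `f = a + r cos u` and `r f` is the area density
(`energyVariation_eq`, `isCriticalPoint_torus`). It is enough that `EL` be the constant `p`.

On the torus `H` and `K` are affine in `w = 1/f`, so `EL` is a polynomial in `w`, linear in the
coefficients of the Lagrange function. Three facts about it carry the proof: its degree is at most
`n + 1` (`natDegree_totalEL_le`); its `w²` coefficient is always zero (`coeff_two_monomialEL`); the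
contribution of `K H^k`, `k ≥ 1`, has degree exactly `k + 3` (`coeff_monomialEL_one_ne_zero`).

Hence the terms `K H^k`, `1 ≤ k ≤ n - 2`, remove the degrees `n + 1, ..., 4` from the top down. What
is left is a constant, a linear term and a cubic term. The coefficient of `1` removes the linear
term and `p` absorbs the constant. The cubic term is removed by `H²`, whose contribution is a pure
`w³` with a factor `a² - 2r²`. If `a² = 2r²` that factor vanishes, and `H³ - HK` takes the place of
`H²`; this changes the coefficient of `H³`, so `n ≥ 4` is needed if the leading one is prescribed.
For `n = 1` the functions `H` and `1` suffice. -/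

theorem integral_box_eq_setIntegral {L : ℝ} (hL : 0 ≤ L) {f : ℝ × ℝ → ℝ}
    (hf : ContinuousOn f (Icc 0 L ×ˢ Icc 0 L)) :
    ∫ u in (0 : ℝ)..L, ∫ v in (0 : ℝ)..L, f (u, v)
      = ∫ q in Icc 0 L ×ˢ Icc 0 L, f q := by
  have hint : IntegrableOn f (Icc 0 L ×ˢ Icc 0 L) (volume.prod volume) :=
    hf.integrableOn_compact (isCompact_Icc.prod isCompact_Icc)
  rw [Measure.volume_eq_prod, setIntegral_prod _ hint]
  simp only [intervalIntegral.integral_of_le hL, integral_Icc_eq_integral_Ioc]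

/-- Differentiation under a double integral over a square, for an integrand that is `C¹` near
the slice `t = 0`. -/
theorem hasDerivAt_integral_box {L : ℝ} (hL : 0 ≤ L) {g : ℝ × ℝ × ℝ → ℝ} {g' : ℝ → ℝ → ℝ}
    (hg : ∀ u v, ContDiffAt ℝ 1 g (0, u, v))
    (hg' : ∀ u v, HasDerivAt (fun t => g (t, u, v)) (g' u v) 0) :
    HasDerivAt (fun t => ∫ u in (0 : ℝ)..L, ∫ v in (0 : ℝ)..L, g (t, u, v))
      (∫ u in (0 : ℝ)..L, ∫ v in (0 : ℝ)..L, g' u v) 0 := by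
  set B : Set (ℝ × ℝ) := Icc 0 L ×ˢ Icc 0 L with hB
  have hBc : IsCompact B := isCompact_Icc.prod isCompact_Icc
  set S : Set (ℝ × ℝ × ℝ) := {x | ContDiffAt ℝ 1 g x} with hS
  have hSo : IsOpen S := by
    rw [isOpen_iff_mem_nhds]
    intro x hx
    exact ContDiffAt.eventually hx (by simp)
  -- Compactness of the square makes the neighbourhood of `t = 0` uniform in `(u, v)`, so that one
  -- constant `M` can dominate the `t`-derivative.
  obtain ⟨A, C, hA, -, h0A, hBC, hAC⟩ := generalized_tube_lemma (isCompact_singleton (x := (0 : ℝ)))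
    hBc hSo (by
      rintro ⟨t, u, v⟩ ⟨ht, -⟩
      obtain rfl : t = 0 := ht
      exact hg u v)
  obtain ⟨ε, hε, hεA⟩ := Metric.isOpen_iff.1 hA 0 (h0A rfl)
  have hmem : ∀ t ∈ Metric.closedBall (0 : ℝ) (ε / 2), ∀ q ∈ B, ContDiffAt ℝ 1 g (t, q) := by
    intro t ht q hq
    exact hAC ⟨hεA (Metric.closedBall_subset_ball (by linarith) ht), hBC hq⟩
  have hcont : ∀ t ∈ Metric.closedBall (0 : ℝ) (ε / 2), ContinuousOn (fun q => g (t, q)) B := by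
    intro t ht q hq
    exact ((hmem t ht q hq).continuousAt.comp
      (continuousAt_const.prodMk continuousAt_id)).continuousWithinAt
  set D : ℝ → ℝ × ℝ → ℝ := fun t q => fderiv ℝ g (t, q) (1, 0) with hD
  have hDcont : ContinuousOn (fun x : ℝ × ℝ × ℝ => D x.1 x.2)
      (Metric.closedBall (0 : ℝ) (ε / 2) ×ˢ B) := by
    rintro ⟨t, q⟩ ⟨ht, hq⟩
    have h := (hmem t ht q hq).continuousAt_fderiv (by simp)
    exact (h.clm_apply continuousAt_const).continuousWithinAt
  obtain ⟨M, hM⟩ := ((isCompact_closedBall (0 : ℝ) (ε / 2)).prod hBc).exists_bound_of_continuousOn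
    hDcont
  have hder : ∀ t ∈ Metric.closedBall (0 : ℝ) (ε / 2), ∀ q ∈ B,
      HasDerivAt (fun s => g (s, q)) (D t q) t := by
    intro t ht q hq
    have h := ((hmem t ht q hq).differentiableAt (by simp)).hasFDerivAt
    exact h.comp_hasDerivAt t ((hasDerivAt_id t).prodMk (hasDerivAt_const t q))
  have h0 : (0 : ℝ) ∈ Metric.closedBall (0 : ℝ) (ε / 2) := by simp; linarith
  have hBm : MeasurableSet B := measurableSet_Icc.prod measurableSet_Icc
  have hball : Metric.closedBall (0 : ℝ) (ε / 2) ∈ 𝓝 (0 : ℝ) :=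
    Metric.closedBall_mem_nhds _ (by linarith)
  have key := hasDerivAt_integral_of_dominated_loc_of_deriv_le (μ := volume.restrict B)
    (F := fun t q => g (t, q)) (F' := D) (bound := fun _ => M) hball
    (by
      filter_upwards [hball] with t ht
      exact (hcont t ht).aestronglyMeasurable hBm)
    ((hcont 0 h0).integrableOn_compact hBc)
    (by
      refine ContinuousOn.aestronglyMeasurable ?_ hBm
      exact hDcont.comp (f := fun q : ℝ × ℝ => ((0 : ℝ), q)) (by fun_prop)
        (fun q hq => ⟨h0, hq⟩))
    (by
      refine (ae_restrict_iff' hBm).2 (Eventually.of_forall fun q hq t ht => hM (t, q) ⟨ht, hq⟩))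
    (continuousOn_const.integrableOn_compact hBc)
    ((ae_restrict_iff' hBm).2 (Eventually.of_forall fun q hq t ht => hder t ht q hq))
  have hD0 : ∀ q ∈ B, D 0 q = g' q.1 q.2 := fun q hq => (hder 0 h0 q hq).unique (hg' q.1 q.2)
  have e1 : ∫ u in (0 : ℝ)..L, ∫ v in (0 : ℝ)..L, g' u v = ∫ q in B, D 0 q := by
    rw [setIntegral_congr_fun hBm hD0]
    refine integral_box_eq_setIntegral hL (f := fun q => g' q.1 q.2) ?_
    refine ContinuousOn.congr (f := D 0) ?_ (fun q hq => (hD0 q hq).symm)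
    exact hDcont.comp (f := fun q : ℝ × ℝ => ((0 : ℝ), q)) (by fun_prop) (fun q hq => ⟨h0, hq⟩)
  rw [e1]
  refine key.2.congr_of_eventuallyEq ?_
  filter_upwards [hball] with t ht
  exact integral_box_eq_setIntegral hL (f := fun q => g (t, q)) (hcont t ht)

/-- The integral of a divergence over the flat torus vanishes. -/
theorem integral_divergence_eq_zero {L : ℝ} (hL : 0 ≤ L) {U V Uu Vv : ℝ → ℝ → ℝ}
    (hU : ∀ u v, HasDerivAt (fun s => U s v) (Uu u v) u)
    (hV : ∀ u v, HasDerivAt (fun s => V u s) (Vv u v) v)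
    (hUu : Continuous fun q : ℝ × ℝ => Uu q.1 q.2)
    (hVv : Continuous fun q : ℝ × ℝ => Vv q.1 q.2)
    (hUper : ∀ v, U L v = U 0 v) (hVper : ∀ u, V u L = V u 0) :
    ∫ u in (0 : ℝ)..L, ∫ v in (0 : ℝ)..L, (Uu u v + Vv u v) = 0 := by
  have hV0 : ∀ u, ∫ v in (0 : ℝ)..L, Vv u v = 0 := by
    intro u
    rw [intervalIntegral.integral_eq_sub_of_hasDerivAt (f := V u) (fun v _ => hV u v)
      ((hVv.comp (by fun_prop : Continuous fun v : ℝ => (u, v))).intervalIntegrable _ _), hVper,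
      sub_self]
  have hU0 : ∀ v, ∫ u in (0 : ℝ)..L, Uu u v = 0 := by
    intro v
    rw [intervalIntegral.integral_eq_sub_of_hasDerivAt (f := fun s => U s v) (fun u _ => hU u v)
      ((hUu.comp (by fun_prop : Continuous fun u : ℝ => (u, v))).intervalIntegrable _ _), hUper,
      sub_self]
  have h1 : ∀ u, ∫ v in (0 : ℝ)..L, (Uu u v + Vv u v) = ∫ v in (0 : ℝ)..L, Uu u v := by
    intro u
    rw [intervalIntegral.integral_add (f := Uu u) (g := Vv u)
      ((hUu.comp (by fun_prop : Continuous fun v : ℝ => (u, v))).intervalIntegrable _ _)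
      ((hVv.comp (by fun_prop : Continuous fun v : ℝ => (u, v))).intervalIntegrable _ _), hV0,
      add_zero]
  simp only [h1]
  -- The `V` part is gone after the inner integral; Fubini makes `u` the inner variable for the `U`
  -- part.
  rw [intervalIntegral_intervalIntegral_swap]
  · simp [hU0]
  · rw [Set.uIoc_of_le hL]
    refine IntegrableOn.mono_set (t := Icc 0 L ×ˢ Icc 0 L) ?_
      (Set.prod_mono Ioc_subset_Icc_self Ioc_subset_Icc_self)
    exact hUu.continuousOn.integrableOn_compact (isCompact_Icc.prod isCompact_Icc)

end

/-! ### The Euler–Lagrange expression as a polynomial in `w`. -/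

section

open Polynomial

/-- The mean curvature of the torus as a polynomial in `w = 1 / (a + r cos u)`. -/
def meanPoly (a r : ℝ) : ℝ[X] := C (1 / r) - C (a / (2 * r)) * X

/-- The Gaussian curvature of the torus as a polynomial in `w = 1 / (a + r cos u)`. -/
def gaussPoly (a r : ℝ) : ℝ[X] := C (1 / r ^ 2) - C (a / r ^ 2) * X

/-- The operator `g(w) ↦ (r f)⁻¹ ∂_u (sin u · g(w))`, where `f = a + r cos u` and `w = 1 / f`. -/
def divPoly (a r : ℝ) (g : ℝ[X]) : ℝ[X] :=
  C (1 / r ^ 2) * ((1 - C a * X) * g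
    + (C (r ^ 2 - a ^ 2) * X ^ 2 + C (2 * a) * X - 1) * (X * derivative g))

/-- The part of the flux that `divPoly` is applied to in the Euler–Lagrange expression; `P` and
`Q` are the derivatives of the Lagrange function in `H` and `K`. -/
def fluxPoly (a r : ℝ) (P Q : ℝ[X]) : ℝ[X] :=
  C (1 / 2) * (X * derivative P) + C (1 / r) * ((1 - C a * X) * (X * derivative Q))

theorem divPoly_add (a r : ℝ) (g h : ℝ[X]) :
    divPoly a r (g + h) = divPoly a r g + divPoly a r h := by
  simp only [divPoly, derivative_add, mul_add]
  ring

theorem divPoly_smul (a r c : ℝ) (g : ℝ[X]) : divPoly a r (c • g) = c • divPoly a r g := by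
  simp only [divPoly, derivative_smul, mul_smul_comm, ← smul_add]

theorem fluxPoly_add (a r : ℝ) (P P' Q Q' : ℝ[X]) :
    fluxPoly a r (P + P') (Q + Q') = fluxPoly a r P Q + fluxPoly a r P' Q' := by
  simp only [fluxPoly, derivative_add, mul_add]
  ring

theorem fluxPoly_smul (a r c : ℝ) (P Q : ℝ[X]) :
    fluxPoly a r (c • P) (c • Q) = c • fluxPoly a r P Q := by
  simp only [fluxPoly, derivative_smul, mul_smul_comm, smul_add]

/-- The Euler–Lagrange expression of the torus, as a polynomial in `w`, for a Lagrange function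
whose `H`-derivative, `K`-derivative and value along the torus are the components of `j`. -/
def eulerLagrange (a r : ℝ) : ℝ[X] × ℝ[X] × ℝ[X] →ₗ[ℝ] ℝ[X] where
  toFun j := divPoly a r (fluxPoly a r j.1 j.2.1)
    + ((2 * meanPoly a r ^ 2 - gaussPoly a r) * j.1
      + 2 * meanPoly a r * gaussPoly a r * j.2.1 - 2 * meanPoly a r * j.2.2)
  map_add' x y := by
    simp only [Prod.fst_add, Prod.snd_add, fluxPoly_add, divPoly_add]
    ring
  map_smul' c x := by
    simp only [Prod.smul_fst, Prod.smul_snd, fluxPoly_smul, divPoly_smul, mul_smul_comm,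
      RingHom.id_apply, smul_add, smul_sub]

theorem eulerLagrange_apply (a r : ℝ) (P Q e : ℝ[X]) :
    eulerLagrange a r (P, Q, e) = divPoly a r (fluxPoly a r P Q)
      + ((2 * meanPoly a r ^ 2 - gaussPoly a r) * P
        + 2 * meanPoly a r * gaussPoly a r * Q - 2 * meanPoly a r * e) := rfl

theorem eval_eulerLagrange (a r x : ℝ) (P Q e : ℝ[X]) :
    (eulerLagrange a r (P, Q, e)).eval x
      = 1 / r ^ 2 * ((1 - a * x) * (1 / 2 * (x * (derivative P).eval x)
            + 1 / r * ((1 - a * x) * (x * (derivative Q).eval x)))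
          + ((r ^ 2 - a ^ 2) * x ^ 2 + 2 * a * x - 1) * (x
            * (1 / 2 * ((derivative P).eval x + x * (derivative (derivative P)).eval x)
              + 1 / r * ((1 - 2 * a * x) * (derivative Q).eval x
                + (1 - a * x) * (x * (derivative (derivative Q)).eval x)))))
        + ((2 * (1 / r - a / (2 * r) * x) ^ 2 - (1 / r ^ 2 - a / r ^ 2 * x)) * P.eval x
          + 2 * (1 / r - a / (2 * r) * x) * (1 / r ^ 2 - a / r ^ 2 * x) * Q.eval x
          - 2 * (1 / r - a / (2 * r) * x) * e.eval x) := by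
  simp only [eulerLagrange_apply, divPoly, fluxPoly, meanPoly, gaussPoly, derivative_add,
    derivative_sub, derivative_mul, derivative_C, derivative_X, derivative_one, eval_add, eval_sub,
    eval_mul, eval_pow, eval_C, eval_X, eval_one, eval_ofNat, eval_zero]
  ring

/-- The components `(E_H, E_K, E)` along the torus of the monomial `E = H ^ k * K ^ m`. -/
def monomialJet (a r : ℝ) (k m : ℕ) : ℝ[X] × ℝ[X] × ℝ[X] :=
  (C (k : ℝ) * meanPoly a r ^ (k - 1) * gaussPoly a r ^ m,
    C (m : ℝ) * meanPoly a r ^ k * gaussPoly a r ^ (m - 1),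
    meanPoly a r ^ k * gaussPoly a r ^ m)

/-- The Euler–Lagrange expression of the monomial `H ^ k * K ^ m`. -/
def monomialEL (a r : ℝ) (k m : ℕ) : ℝ[X] := eulerLagrange a r (monomialJet a r k m)

/-- Chain rule along the line `w ↦ (H, K)`, whose velocity is `(-a/(2r), -a/r²)`. This compatibility
of the three components is all that the vanishing of the `w²` coefficient uses. -/
theorem derivative_monomialJet (a r : ℝ) (k m : ℕ) :
    derivative (monomialJet a r k m).2.2
      = C (-(a / (2 * r))) * (monomialJet a r k m).1
        + C (-(a / r ^ 2)) * (monomialJet a r k m).2.1 := by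
  simp only [monomialJet, derivative_mul, derivative_pow, meanPoly, gaussPoly, derivative_sub,
    derivative_C, derivative_X, map_neg]
  ring

theorem two_mul_coeff_two (p : ℝ[X]) :
    2 * p.coeff 2 = eval 0 (derivative (derivative p)) := by
  rw [← coeff_zero_eq_eval_zero, coeff_derivative, coeff_derivative]
  push_cast
  ring

/-- Once `e'` and `e''` at `0` are expressed through `P` and `Q`, the contributions of the Taylor
coefficients of `P` and `Q` at `0` cancel one by one. This is why `n + 1` unknowns are enough for an
expression of degree `n + 1`. -/
theorem coeff_two_eulerLagrange {a r : ℝ} (hr : r ≠ 0) {P Q e : ℝ[X]}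
    (he : derivative e = C (-(a / (2 * r))) * P + C (-(a / r ^ 2)) * Q) :
    (eulerLagrange a r (P, Q, e)).coeff 2 = 0 := by
  have h : eval 0 (derivative (derivative (eulerLagrange a r (P, Q, e)))) = 0 := by
    simp only [eulerLagrange_apply, divPoly, fluxPoly, meanPoly,
      gaussPoly, derivative_add, derivative_sub, derivative_mul, pow_two, derivative_C,
      derivative_X, derivative_one, derivative_ofNat, he, eval_add, eval_sub, eval_mul,
      eval_C, eval_X, eval_one, eval_ofNat, eval_zero, derivative_zero]
    field_simp
    ring
  rw [← two_mul_coeff_two] at h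
  linarith

theorem coeff_two_monomialEL {a r : ℝ} (hr : r ≠ 0) (k m : ℕ) :
    (monomialEL a r k m).coeff 2 = 0 :=
  coeff_two_eulerLagrange hr (derivative_monomialJet a r k m)

/-! ### Degree bounds and explicit low-order contributions. -/

theorem natDegree_X_mul_derivative_le (p : ℝ[X]) : (X * derivative p).natDegree ≤ p.natDegree := by
  rw [natDegree_le_iff_coeff_eq_zero]
  rintro (_ | N) hN
  · simp
  · rw [coeff_X_mul, coeff_derivative, coeff_eq_zero_of_natDegree_lt hN, zero_mul]

theorem natDegree_meanPoly_le (a r : ℝ) : (meanPoly a r).natDegree ≤ 1 := by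
  unfold meanPoly; compute_degree

theorem natDegree_gaussPoly_le (a r : ℝ) : (gaussPoly a r).natDegree ≤ 1 := by
  unfold gaussPoly; compute_degree

theorem natDegree_one_sub_C_mul_X_le (a : ℝ) : (1 - C a * X : ℝ[X]).natDegree ≤ 1 := by
  compute_degree

theorem natDegree_divPoly_le {a r : ℝ} {g : ℝ[X]} {N : ℕ} (hg : g.natDegree ≤ N) :
    (divPoly a r g).natDegree ≤ N + 2 := by
  refine (natDegree_C_mul_le _ _).trans (natDegree_add_le_of_degree_le ?_ ?_)
  · refine (natDegree_mul_le_of_le (natDegree_one_sub_C_mul_X_le a) hg).trans (by omega)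
  · have h2 : (C (r ^ 2 - a ^ 2) * X ^ 2 + C (2 * a) * X - 1 : ℝ[X]).natDegree ≤ 2 := by
      compute_degree
    exact (natDegree_mul_le_of_le h2 ((natDegree_X_mul_derivative_le g).trans hg)).trans (by omega)

theorem natDegree_remainder_le {a r : ℝ} {P Q e : ℝ[X]} {N : ℕ} (hP : P.natDegree ≤ N)
    (hQ : Q.natDegree ≤ N) (he : e.natDegree ≤ N + 1) :
    ((2 * meanPoly a r ^ 2 - gaussPoly a r) * P
      + 2 * meanPoly a r * gaussPoly a r * Q - 2 * meanPoly a r * e).natDegree ≤ N + 2 := by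
  have h1 := natDegree_meanPoly_le a r
  have h2 := natDegree_gaussPoly_le a r
  have h0 : (2 : ℝ[X]).natDegree ≤ 0 := by simp
  have h2h : (2 * meanPoly a r).natDegree ≤ 1 := natDegree_mul_le_of_le h0 h1
  have hsq : (2 * meanPoly a r ^ 2 - gaussPoly a r).natDegree ≤ 2 := by
    refine (natDegree_sub_le_of_le (m := 2) (n := 2) ?_ (h2.trans (by omega))).trans (by simp)
    exact (natDegree_mul_le_of_le h0 (natDegree_pow_le_of_le 2 h1)).trans (by omega)
  refine (natDegree_sub_le_of_le (n := N + 2) (m := N + 2)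
    (natDegree_add_le_of_degree_le ?_ ?_) ?_).trans (by simp)
  · exact (natDegree_mul_le_of_le hsq hP).trans (by omega)
  · exact (natDegree_mul_le_of_le (natDegree_mul_le_of_le h2h h2) hQ).trans (by omega)
  · exact (natDegree_mul_le_of_le h2h he).trans (by omega)

/-- The operator `divPoly` raises the degree by two, and the factor `1 - aX` next to `Q` in the flux
by one more; so `Q` must be one degree below `P`. The alternative `Q = 0` covers pure powers of `H`,
where `N = 0` can occur. -/
theorem natDegree_eulerLagrange_le {a r : ℝ} {P Q e : ℝ[X]} {N : ℕ} (hP : P.natDegree ≤ N)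
    (hQ : Q = 0 ∨ Q.natDegree + 1 ≤ N) (he : e.natDegree ≤ N + 1) :
    (eulerLagrange a r (P, Q, e)).natDegree ≤ N + 2 := by
  have hQ' : Q.natDegree ≤ N := by rcases hQ with rfl | h <;> [simp; omega]
  have hflux : (fluxPoly a r P Q).natDegree ≤ N := by
    refine natDegree_add_le_of_degree_le ?_ ?_
    · exact (natDegree_C_mul_le _ _).trans ((natDegree_X_mul_derivative_le P).trans hP)
    · refine (natDegree_C_mul_le _ _).trans ?_
      rcases hQ with rfl | h
      · simp
      · refine (natDegree_mul_le_of_le (natDegree_one_sub_C_mul_X_le a)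
          (natDegree_X_mul_derivative_le Q)).trans (by omega)
  exact natDegree_add_le_of_degree_le (natDegree_divPoly_le hflux) (natDegree_remainder_le hP hQ' he)

theorem natDegree_mean_pow_mul_gauss_pow_le (a r c : ℝ) (k m : ℕ) :
    (C c * meanPoly a r ^ k * gaussPoly a r ^ m).natDegree ≤ k + m := by
  refine natDegree_mul_le_of_le ((natDegree_C_mul_le _ _).trans ?_) ?_
  · simpa using natDegree_pow_le_of_le k (natDegree_meanPoly_le a r)
  · simpa using natDegree_pow_le_of_le m (natDegree_gaussPoly_le a r)

theorem monomialEL_zero_zero (a r : ℝ) :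
    monomialEL a r 0 0 = C (-(2 / r)) + C (a / r) * X := by
  refine Polynomial.funext fun x => ?_
  rw [monomialEL, monomialJet, eval_eulerLagrange]
  simp
  ring

theorem monomialEL_one_zero {a r : ℝ} (hr : r ≠ 0) :
    monomialEL a r 1 0 = C (-(1 / r ^ 2)) + C (a / r ^ 2) * X := by
  refine Polynomial.funext fun x => ?_
  rw [monomialEL, monomialJet, eval_eulerLagrange]
  simp [meanPoly]
  field_simp
  ring

/-- The Willmore integrand. Its contribution is a single cubic term, vanishing exactly at the
Clifford ratio `a² = 2r²`. -/
theorem monomialEL_two_zero {a r : ℝ} (hr : r ≠ 0) :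
    monomialEL a r 2 0 = C (a * (a ^ 2 - 2 * r ^ 2) / (4 * r ^ 3)) * X ^ 3 := by
  refine Polynomial.funext fun x => ?_
  rw [monomialEL, monomialJet, eval_eulerLagrange]
  simp [meanPoly]
  field_simp
  ring

/-- At the Clifford ratio the quartic terms of `H³` and `HK` cancel, leaving a nonzero multiple of
`w³` to replace the lost one of `H²`. -/
theorem monomialEL_three_zero_sub {a r : ℝ} (hr : r ≠ 0) (h : a ^ 2 = 2 * r ^ 2) :
    monomialEL a r 3 0 - monomialEL a r 1 1 = C (a / (2 * r ^ 2)) * X ^ 3 := by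
  refine Polynomial.funext fun x => ?_
  rw [eval_sub, monomialEL, monomialEL, monomialJet, monomialJet, eval_eulerLagrange,
    eval_eulerLagrange]
  simp [meanPoly, gaussPoly, derivative_pow]
  field_simp
  linear_combination (4 * a * x ^ 3 - 2 * a ^ 2 * x ^ 4) * h

theorem natDegree_monomialEL_zero_le (a r : ℝ) (k : ℕ) :
    (monomialEL a r k 0).natDegree ≤ k + 1 := by
  rcases k with _ | k
  · rw [monomialEL_zero_zero]
    compute_degree
  · refine natDegree_eulerLagrange_le (N := k) ?_ (Or.inl (by simp)) ?_
    · simpa only [Nat.add_sub_cancel, add_zero] using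
        natDegree_mean_pow_mul_gauss_pow_le a r ((k + 1 : ℕ) : ℝ) k 0
    · simpa only [C_1, one_mul, add_zero] using natDegree_mean_pow_mul_gauss_pow_le a r 1 (k + 1) 0

theorem natDegree_monomialEL_le (a r : ℝ) {k m : ℕ} (hk : 1 ≤ k) (hm : 1 ≤ m) :
    (monomialEL a r k m).natDegree ≤ k + m + 2 := by
  refine natDegree_eulerLagrange_le (N := k + m) ?_ (Or.inr ?_) ?_
  · exact (natDegree_mean_pow_mul_gauss_pow_le a r _ _ _).trans (by omega)
  · have := natDegree_mean_pow_mul_gauss_pow_le a r m k (m - 1)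
    omega
  · have := natDegree_mean_pow_mul_gauss_pow_le a r 1 k m
    rw [C_1, one_mul] at this
    omega

/-- Only the `E_K = H^k` part of the flux reaches degree `k + 3`: `X Q'` has degree at most `k`, the
factor `1 - aX` adds one and the quadratic factor in `divPoly` adds two. All other terms stop at
degree `k + 2`. The factors `k` and `k + 1` come from the two applications of `X d/dX`. -/
theorem coeff_monomialEL_one (a r : ℝ) {k : ℕ} (hk : 1 ≤ k) :
    (monomialEL a r k 1).coeff (k + 3)
      = 1 / r ^ 2 * ((r ^ 2 - a ^ 2)
        * ((k + 1) * (1 / r * (-a * (k * (-(a / (2 * r))) ^ k))))) := by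
  set Q : ℝ[X] := meanPoly a r ^ k with hQ
  have hQdeg : Q.natDegree ≤ k := by
    simpa only [mul_one] using natDegree_pow_le_of_le k (natDegree_meanPoly_le a r)
  have hXQ : (X * derivative Q).natDegree ≤ k := (natDegree_X_mul_derivative_le Q).trans hQdeg
  have hcQ : Q.coeff k = (-(a / (2 * r))) ^ k := by
    have h := coeff_pow_of_natDegree_le (m := k) (natDegree_meanPoly_le a r)
    rw [mul_one] at h
    rw [hQ, h]
    simp [meanPoly, coeff_C]
  have hcXQ : (X * derivative Q).coeff k = k * (-(a / (2 * r))) ^ k := by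
    obtain ⟨l, rfl⟩ : ∃ l, k = l + 1 := ⟨k - 1, by omega⟩
    rw [coeff_X_mul, coeff_derivative, hcQ]
    push_cast
    ring
  set g : ℝ[X] := (1 - C a * X) * (X * derivative Q) with hg
  have hgdeg : (C (1 / r) * g).natDegree ≤ k + 1 :=
    (natDegree_C_mul_le _ _).trans
      ((natDegree_mul_le_of_le (natDegree_one_sub_C_mul_X_le a) hXQ).trans (by omega))
  have hcg : g.coeff (k + 1) = -a * (k * (-(a / (2 * r))) ^ k) := by
    rw [hg, add_comm, coeff_mul_add_eq_of_natDegree_le (natDegree_one_sub_C_mul_X_le a) hXQ, hcXQ]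
    simp [coeff_one]
  have hX : (X * derivative (C (1 / r) * g)).natDegree ≤ k + 1 :=
    (natDegree_X_mul_derivative_le _).trans hgdeg
  have hcX : (X * derivative (C (1 / r) * g)).coeff (k + 1)
      = (k + 1) * (1 / r * (-a * (k * (-(a / (2 * r))) ^ k))) := by
    rw [coeff_X_mul, coeff_derivative, coeff_C_mul, hcg]
    ring
  have hquad : (C (r ^ 2 - a ^ 2) * X ^ 2 + C (2 * a) * X - 1 : ℝ[X]).natDegree ≤ 2 := by
    compute_degree
  have hcquad : (C (r ^ 2 - a ^ 2) * X ^ 2 + C (2 * a) * X - 1 : ℝ[X]).coeff 2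
      = r ^ 2 - a ^ 2 := by
    rw [coeff_sub, coeff_add, coeff_C_mul_X_pow, coeff_C_mul, coeff_X, coeff_one]
    simp
  have hmain : (divPoly a r (C (1 / r) * g)).coeff (k + 3)
      = 1 / r ^ 2 * ((r ^ 2 - a ^ 2)
        * ((k + 1) * (1 / r * (-a * (k * (-(a / (2 * r))) ^ k))))) := by
    rw [divPoly, coeff_C_mul, coeff_add, coeff_eq_zero_of_natDegree_lt (p := (1 - C a * X) * _),
      zero_add, show k + 3 = 2 + (k + 1) by omega, coeff_mul_add_eq_of_natDegree_le hquad hX, hcquad,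
      hcX]
    exact (natDegree_mul_le_of_le (natDegree_one_sub_C_mul_X_le a) hgdeg).trans_lt (by omega)
  set P : ℝ[X] := C (k : ℝ) * meanPoly a r ^ (k - 1) * gaussPoly a r ^ 1 with hP
  have hPdeg : P.natDegree ≤ k :=
    (natDegree_mean_pow_mul_gauss_pow_le a r _ _ _).trans (by omega)
  have hedeg : (Q * gaussPoly a r ^ 1).natDegree ≤ k + 1 :=
    (natDegree_mul_le_of_le hQdeg (natDegree_pow_le_of_le 1 (natDegree_gaussPoly_le a r)))
  have hsplit : monomialEL a r k 1 = divPoly a r (C (1 / r) * g)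
      + (divPoly a r (C (1 / 2) * (X * derivative P))
        + ((2 * meanPoly a r ^ 2 - gaussPoly a r) * P
          + 2 * meanPoly a r * gaussPoly a r * Q
            - 2 * meanPoly a r * (Q * gaussPoly a r ^ 1))) := by
    rw [monomialEL, monomialJet, ← hP, ← hQ, Nat.cast_one, C_1, one_mul, Nat.sub_self, pow_zero,
      mul_one, eulerLagrange_apply, fluxPoly, ← hg, divPoly_add]
    ring
  rw [hsplit, coeff_add, hmain, coeff_eq_zero_of_natDegree_lt, add_zero]
  refine lt_of_le_of_lt (natDegree_add_le_of_degree_le (n := k + 2) (natDegree_divPoly_le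
    ((natDegree_C_mul_le _ _).trans ((natDegree_X_mul_derivative_le P).trans hPdeg)))
    (natDegree_remainder_le hPdeg hQdeg hedeg)) (by omega)

theorem coeff_monomialEL_one_ne_zero {a r : ℝ} (hr : 0 < r) (har : r < a) {k : ℕ} (hk : 1 ≤ k) :
    (monomialEL a r k 1).coeff (k + 3) ≠ 0 := by
  have ha : a ≠ 0 := by linarith
  have hr' : r ≠ 0 := hr.ne'
  have h1 : r ^ 2 - a ^ 2 ≠ 0 := by nlinarith
  have h2 : (k : ℝ) ≠ 0 := by positivity
  have h3 : (k : ℝ) + 1 ≠ 0 := by positivity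
  rw [coeff_monomialEL_one a r hk]
  simp [ha, hr', h1, h2, h3]

/-- Adding multiples of the Euler–Lagrange expressions of `K * H ^ k`, `1 ≤ k ≤ d`, reduces any
polynomial of degree at most `d + 3` to one of degree at most `3`. -/
theorem exists_natDegree_add_sum_monomialEL_le {a r : ℝ} (hr : 0 < r) (har : r < a) (d : ℕ) :
    ∀ q : ℝ[X], q.natDegree ≤ d + 3 → ∃ b : ℕ → ℝ,
      (q + ∑ k ∈ Finset.Icc 1 d, b k • monomialEL a r k 1).natDegree ≤ 3 := by
  induction d with
  | zero => exact fun q hq => ⟨0, by simpa using hq⟩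
  | succ d ih =>
    intro q hq
    set c : ℝ := -(q.coeff (d + 4) / (monomialEL a r (d + 1) 1).coeff (d + 4)) with hc
    have hne : (monomialEL a r (d + 1) 1).coeff (d + 4) ≠ 0 :=
      coeff_monomialEL_one_ne_zero hr har (k := d + 1) (by omega)
    have hdeg : (monomialEL a r (d + 1) 1).natDegree ≤ d + 4 :=
      natDegree_monomialEL_le a r (by omega) le_rfl
    obtain ⟨b, hb⟩ := ih (q + c • monomialEL a r (d + 1) 1) (by
      rw [natDegree_le_iff_coeff_eq_zero]
      intro N hN
      rcases eq_or_lt_of_le (Nat.succ_le_of_lt hN) with h | h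
      · obtain rfl : N = d + 4 := by omega
        rw [coeff_add, coeff_smul, smul_eq_mul, hc]
        field_simp
        ring
      · rw [coeff_add, coeff_smul, coeff_eq_zero_of_natDegree_lt (by omega),
          coeff_eq_zero_of_natDegree_lt (by omega), smul_zero, add_zero])
    refine ⟨Function.update b (d + 1) c, ?_⟩
    convert hb using 2
    rw [Finset.sum_Icc_succ_top (by omega), Function.update_self,
      Finset.sum_congr rfl (g := fun k => b k • monomialEL a r k 1)]
    · abel
    · intro k hk
      rw [Function.update_of_ne]
      have := (Finset.mem_Icc.1 hk).2
      omega

theorem eq_cubic_of_coeff_two_eq_zero {q : ℝ[X]} (hq : q.natDegree ≤ 3) (h2 : q.coeff 2 = 0) :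
    q = C (q.coeff 0) + C (q.coeff 1) * X + C (q.coeff 3) * X ^ 3 := by
  conv_lhs => rw [q.as_sum_range_C_mul_X_pow' (n := 4) (by omega)]
  simp [Finset.sum_range_succ, h2]

end

/-! ### Geometry of tubes of variable radius. -/

section

open Real

/-- `ρu`, `ρv`, `ρuu`, `ρuv`, `ρvv` are the partial derivatives of `ρ` up to order two. -/
structure IsJet (ρ ρu ρv ρuu ρuv ρvv : ℝ → ℝ → ℝ) : Prop where
  hu : ∀ u v, HasDerivAt (fun s => ρ s v) (ρu u v) u
  hv : ∀ u v, HasDerivAt (fun s => ρ u s) (ρv u v) v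
  huu : ∀ u v, HasDerivAt (fun s => ρu s v) (ρuu u v) u
  huv : ∀ u v, HasDerivAt (fun s => ρu u s) (ρuv u v) v
  hvv : ∀ u v, HasDerivAt (fun s => ρv u s) (ρvv u v) v

/-- The surface at distance `ρ (u, v)` from the core circle of radius `a`. -/
def tube (a : ℝ) (ρ : ℝ → ℝ → ℝ) : ParamSurface :=
  fun u v => ![(a + ρ u v * cos u) * cos v, (a + ρ u v * cos u) * sin v, ρ u v * sin u]

theorem hasDerivAt_vec3 {f g h : ℝ → ℝ} {f' g' h' x : ℝ} (hf : HasDerivAt f f' x)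
    (hg : HasDerivAt g g' x) (hh : HasDerivAt h h' x) :
    HasDerivAt (fun s => ![f s, g s, h s]) ![f', g', h'] x := by
  rw [hasDerivAt_pi]
  intro i
  fin_cases i <;> simpa

variable {a : ℝ} {ρ ρu ρv ρuu ρuv ρvv : ℝ → ℝ → ℝ}

theorem partialU_tube (h : IsJet ρ ρu ρv ρuu ρuv ρvv) :
    partialU (tube a ρ) = fun u v => ![(ρu u v * cos u - ρ u v * sin u) * cos v,
      (ρu u v * cos u - ρ u v * sin u) * sin v, ρu u v * sin u + ρ u v * cos u] := by
  funext u v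
  have hc := (h.hu u v).mul (hasDerivAt_cos u)
  refine (hasDerivAt_vec3 ((hc.const_add a).mul_const (cos v)) ((hc.const_add a).mul_const (sin v))
    ((h.hu u v).mul (hasDerivAt_sin u))).deriv.trans ?_
  simp only [mul_neg, ← sub_eq_add_neg]

theorem partialV_tube (h : IsJet ρ ρu ρv ρuu ρuv ρvv) :
    partialV (tube a ρ) = fun u v => ![ρv u v * cos u * cos v - (a + ρ u v * cos u) * sin v,
      ρv u v * cos u * sin v + (a + ρ u v * cos u) * cos v, ρv u v * sin u] := by
  funext u v
  have hc := ((h.hv u v).mul_const (cos u)).const_add a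
  refine (hasDerivAt_vec3 (hc.mul (hasDerivAt_cos v)) (hc.mul (hasDerivAt_sin v))
    ((h.hv u v).mul_const (sin u))).deriv.trans ?_
  simp only [mul_neg, ← sub_eq_add_neg]

theorem partialUU_tube (h : IsJet ρ ρu ρv ρuu ρuv ρvv) :
    partialU (partialU (tube a ρ)) = fun u v =>
      ![(ρuu u v * cos u - 2 * ρu u v * sin u - ρ u v * cos u) * cos v,
        (ρuu u v * cos u - 2 * ρu u v * sin u - ρ u v * cos u) * sin v,
        ρuu u v * sin u + 2 * ρu u v * cos u - ρ u v * sin u] := by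
  rw [partialU_tube h]
  funext u v
  have hc := ((h.huu u v).mul (hasDerivAt_cos u)).sub ((h.hu u v).mul (hasDerivAt_sin u))
  refine (hasDerivAt_vec3 (hc.mul_const (cos v)) (hc.mul_const (sin v))
    (((h.huu u v).mul (hasDerivAt_sin u)).add
      ((h.hu u v).mul (hasDerivAt_cos u)))).deriv.trans ?_
  ext i
  fin_cases i <;> simp [-mul_eq_mul_right_iff] <;> ring

theorem partialVU_tube (h : IsJet ρ ρu ρv ρuu ρuv ρvv) :
    partialV (partialU (tube a ρ)) = fun u v =>
      ![(ρuv u v * cos u - ρv u v * sin u) * cos v - (ρu u v * cos u - ρ u v * sin u) * sin v,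
        (ρuv u v * cos u - ρv u v * sin u) * sin v + (ρu u v * cos u - ρ u v * sin u) * cos v,
        ρuv u v * sin u + ρv u v * cos u] := by
  rw [partialU_tube h]
  funext u v
  have hc := ((h.huv u v).mul_const (cos u)).sub ((h.hv u v).mul_const (sin u))
  refine (hasDerivAt_vec3 (hc.mul (hasDerivAt_cos v)) (hc.mul (hasDerivAt_sin v))
    (((h.huv u v).mul_const (sin u)).add
      ((h.hv u v).mul_const (cos u)))).deriv.trans ?_
  ext i
  fin_cases i <;> simp <;> ring

theorem partialVV_tube (h : IsJet ρ ρu ρv ρuu ρuv ρvv) :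
    partialV (partialV (tube a ρ)) = fun u v =>
      ![(ρvv u v * cos u - (a + ρ u v * cos u)) * cos v - 2 * ρv u v * cos u * sin v,
        (ρvv u v * cos u - (a + ρ u v * cos u)) * sin v + 2 * ρv u v * cos u * cos v,
        ρvv u v * sin u] := by
  rw [partialV_tube h]
  funext u v
  have hc := (h.hvv u v).mul_const (cos u)
  have hd := ((h.hv u v).mul_const (cos u)).const_add a
  refine (hasDerivAt_vec3 ((hc.mul (hasDerivAt_cos v)).sub (hd.mul (hasDerivAt_sin v)))
    ((hc.mul (hasDerivAt_sin v)).add (hd.mul (hasDerivAt_cos v)))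
    ((h.hvv u v).mul_const (sin u))).deriv.trans ?_
  ext i
  fin_cases i <;> simp <;> ring

theorem cross_partial_tube (h : IsJet ρ ρu ρv ρuu ρuv ρvv) (u v : ℝ) :
    partialU (tube a ρ) u v ⨯₃ partialV (tube a ρ) u v =
      ![-(ρu u v * (a + ρ u v * cos u) * sin u + ρ u v * (a + ρ u v * cos u) * cos u) * cos v
          - ρ u v * ρv u v * sin v,
        -(ρu u v * (a + ρ u v * cos u) * sin u + ρ u v * (a + ρ u v * cos u) * cos u) * sin v
          + ρ u v * ρv u v * cos v,
        ρu u v * (a + ρ u v * cos u) * cos u - ρ u v * (a + ρ u v * cos u) * sin u] := by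
  have hu := cos_sq_add_sin_sq u
  have hv := cos_sq_add_sin_sq v
  rw [partialU_tube h, partialV_tube h, cross_apply]
  ext i
  fin_cases i
  · simp
    linear_combination (-(ρ u v * ρv u v * sin v)) * hu
  · simp
    linear_combination (ρ u v * ρv u v * cos v) * hu
  · simp
    linear_combination ((ρu u v * cos u - ρ u v * sin u) * (a + ρ u v * cos u)) * hv

/-- `det I` of a tube in terms of the 2-jet of the radius; `c`, `s` stand for `cos u`, `sin u`. -/
def jetDet (a c ρ ρu ρv : ℝ) : ℝ := ρ ^ 2 * ρv ^ 2 + (a + ρ * c) ^ 2 * (ρu ^ 2 + ρ ^ 2)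

/-- The second fundamental form of a tube, multiplied by the area density. -/
def jetL (a c ρ ρu ρuu : ℝ) : ℝ := (a + ρ * c) * (2 * ρu ^ 2 - ρ * (ρuu - ρ))

def jetM (a c s ρ ρu ρv ρuv : ℝ) : ℝ :=
  (a + ρ * c) * (ρu * ρv - ρ * ρuv) + ρ * ρv * (ρu * c - ρ * s)

def jetN (a c s ρ ρu ρv ρvv : ℝ) : ℝ :=
  ρu * (a + ρ * c) ^ 2 * s + 2 * ρ * ρv ^ 2 * c - ρ * (a + ρ * c) * (ρvv - (a + ρ * c) * c)

theorem firstE_tube (h : IsJet ρ ρu ρv ρuu ρuv ρvv) (u v : ℝ) :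
    firstE (tube a ρ) u v = ρu u v ^ 2 + ρ u v ^ 2 := by
  have hu := cos_sq_add_sin_sq u
  have hv := cos_sq_add_sin_sq v
  rw [firstE, partialU_tube h]
  simp only [Matrix.vec3_dotProduct, Matrix.cons_val]
  grind

theorem firstF_tube (h : IsJet ρ ρu ρv ρuu ρuv ρvv) (u v : ℝ) :
    firstF (tube a ρ) u v = ρu u v * ρv u v := by
  have hu := cos_sq_add_sin_sq u
  have hv := cos_sq_add_sin_sq v
  rw [firstF, partialU_tube h, partialV_tube h]
  simp only [Matrix.vec3_dotProduct, Matrix.cons_val]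
  grind

theorem firstG_tube (h : IsJet ρ ρu ρv ρuu ρuv ρvv) (u v : ℝ) :
    firstG (tube a ρ) u v = ρv u v ^ 2 + (a + ρ u v * cos u) ^ 2 := by
  have hu := cos_sq_add_sin_sq u
  have hv := cos_sq_add_sin_sq v
  rw [firstG, partialV_tube h]
  simp only [Matrix.vec3_dotProduct, Matrix.cons_val]
  grind

theorem detFirst_tube (h : IsJet ρ ρu ρv ρuu ρuv ρvv) (u v : ℝ) :
    detFirst (tube a ρ) u v = jetDet a (cos u) (ρ u v) (ρu u v) (ρv u v) := by
  rw [detFirst, firstE_tube h, firstF_tube h, firstG_tube h, jetDet]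
  ring

theorem secondL_tube (h : IsJet ρ ρu ρv ρuu ρuv ρvv) (u v : ℝ) :
    secondL (tube a ρ) u v = (areaDensity (tube a ρ) u v)⁻¹
      * jetL a (cos u) (ρ u v) (ρu u v) (ρuu u v) := by
  have hu := cos_sq_add_sin_sq u
  have hv := cos_sq_add_sin_sq v
  rw [secondL, unitNormal, dotProduct_smul, smul_eq_mul, cross_partial_tube h, partialUU_tube h]
  congr 1
  simp only [Matrix.vec3_dotProduct, Matrix.cons_val, jetL]
  grind

theorem secondM_tube (h : IsJet ρ ρu ρv ρuu ρuv ρvv) (u v : ℝ) :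
    secondM (tube a ρ) u v = (areaDensity (tube a ρ) u v)⁻¹
      * jetM a (cos u) (sin u) (ρ u v) (ρu u v) (ρv u v) (ρuv u v) := by
  have hu := cos_sq_add_sin_sq u
  have hv := cos_sq_add_sin_sq v
  rw [secondM, unitNormal, dotProduct_smul, smul_eq_mul, cross_partial_tube h, partialVU_tube h]
  congr 1
  simp only [Matrix.vec3_dotProduct, Matrix.cons_val, jetM]
  grind

theorem secondN_tube (h : IsJet ρ ρu ρv ρuu ρuv ρvv) (u v : ℝ) :
    secondN (tube a ρ) u v = (areaDensity (tube a ρ) u v)⁻¹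
      * jetN a (cos u) (sin u) (ρ u v) (ρu u v) (ρv u v) (ρvv u v) := by
  have hu := cos_sq_add_sin_sq u
  have hv := cos_sq_add_sin_sq v
  rw [secondN, unitNormal, dotProduct_smul, smul_eq_mul, cross_partial_tube h, partialVV_tube h]
  congr 1
  simp only [Matrix.vec3_dotProduct, Matrix.cons_val, jetN]
  grind

/-- The mean curvature of a tube in terms of the 2-jet of the radius. -/
def jetMean (a c s ρ ρu ρv ρuu ρuv ρvv : ℝ) : ℝ :=
  ((ρu ^ 2 + ρ ^ 2) * jetN a c s ρ ρu ρv ρvv - 2 * (ρu * ρv * jetM a c s ρ ρu ρv ρuv)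
    + (ρv ^ 2 + (a + ρ * c) ^ 2) * jetL a c ρ ρu ρuu)
    / (2 * jetDet a c ρ ρu ρv * √(jetDet a c ρ ρu ρv))

/-- The Gaussian curvature of a tube in terms of the 2-jet of the radius. -/
def jetGauss (a c s ρ ρu ρv ρuu ρuv ρvv : ℝ) : ℝ :=
  (jetL a c ρ ρu ρuu * jetN a c s ρ ρu ρv ρvv - jetM a c s ρ ρu ρv ρuv ^ 2)
    / jetDet a c ρ ρu ρv ^ 2

/-- The density `X · (X_u × X_v)` of a tube in terms of the 1-jet of the radius. -/
def jetVolume (a c s ρ ρu : ℝ) : ℝ := -((a + ρ * c) * (a * s * ρu + (a * c + ρ) * ρ))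

theorem areaDensity_tube (h : IsJet ρ ρu ρv ρuu ρuv ρvv) (u v : ℝ) :
    areaDensity (tube a ρ) u v = √(jetDet a (cos u) (ρ u v) (ρu u v) (ρv u v)) := by
  rw [areaDensity, detFirst_tube h]

theorem meanCurvature_tube (h : IsJet ρ ρu ρv ρuu ρuv ρvv) (u v : ℝ) :
    meanCurvature (tube a ρ) u v = jetMean a (cos u) (sin u) (ρ u v) (ρu u v) (ρv u v)
      (ρuu u v) (ρuv u v) (ρvv u v) := by
  rw [meanCurvature, firstE_tube h, firstF_tube h, firstG_tube h, secondL_tube h, secondM_tube h,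
    secondN_tube h, detFirst_tube h, areaDensity_tube h, jetMean, ← div_div]
  ring

theorem gaussCurvature_tube (h : IsJet ρ ρu ρv ρuu ρuv ρvv) (u v : ℝ) :
    gaussCurvature (tube a ρ) u v = jetGauss a (cos u) (sin u) (ρ u v) (ρu u v) (ρv u v)
      (ρuu u v) (ρuv u v) (ρvv u v) := by
  have hW : 0 ≤ jetDet a (cos u) (ρ u v) (ρu u v) (ρv u v) := by
    unfold jetDet; positivity
  have hsq : ((√(jetDet a (cos u) (ρ u v) (ρu u v) (ρv u v)))⁻¹) ^ 2
      = (jetDet a (cos u) (ρ u v) (ρu u v) (ρv u v))⁻¹ := by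
    rw [inv_pow, sq_sqrt hW]
  rw [gaussCurvature, secondL_tube h, secondM_tube h, secondN_tube h, detFirst_tube h,
    areaDensity_tube h, jetGauss, div_eq_mul_inv, div_eq_mul_inv, pow_two (jetDet _ _ _ _ _),
    mul_inv]
  linear_combination ((jetL a (cos u) (ρ u v) (ρu u v) (ρuu u v)
    * jetN a (cos u) (sin u) (ρ u v) (ρu u v) (ρv u v) (ρvv u v)
    - jetM a (cos u) (sin u) (ρ u v) (ρu u v) (ρv u v) (ρuv u v) ^ 2)
      * (jetDet a (cos u) (ρ u v) (ρu u v) (ρv u v))⁻¹) * hsq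

theorem tube_dotProduct_cross (h : IsJet ρ ρu ρv ρuu ρuv ρvv) (u v : ℝ) :
    tube a ρ u v ⬝ᵥ (partialU (tube a ρ) u v ⨯₃ partialV (tube a ρ) u v)
      = jetVolume a (cos u) (sin u) (ρ u v) (ρu u v) := by
  have hu := cos_sq_add_sin_sq u
  have hv := cos_sq_add_sin_sq v
  rw [cross_partial_tube h, tube]
  simp only [Matrix.vec3_dotProduct, Matrix.cons_val, jetVolume]
  grind

theorem torus_eq_tube (a r : ℝ) : torus a r = tube a fun _ _ => r := rfl

theorem isJet_const (r : ℝ) :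
    IsJet (fun _ _ => r) (fun _ _ => 0) (fun _ _ => 0) (fun _ _ => 0) (fun _ _ => 0)
      fun _ _ => 0 where
  hu _ _ := hasDerivAt_const _ _
  hv _ _ := hasDerivAt_const _ _
  huu _ _ := hasDerivAt_const _ _
  huv _ _ := hasDerivAt_const _ _
  hvv _ _ := hasDerivAt_const _ _

theorem IsJet.const_sub_mul (h : IsJet ρ ρu ρv ρuu ρuv ρvv) (r t : ℝ) :
    IsJet (fun u v => r - t * ρ u v) (fun u v => -(t * ρu u v)) (fun u v => -(t * ρv u v))
      (fun u v => -(t * ρuu u v)) (fun u v => -(t * ρuv u v)) (fun u v => -(t * ρvv u v)) where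
  hu u v := ((h.hu u v).const_mul t).const_sub r
  hv u v := ((h.hv u v).const_mul t).const_sub r
  huu u v := ((h.huu u v).const_mul t).neg
  huv u v := ((h.huv u v).const_mul t).neg
  hvv u v := ((h.hvv u v).const_mul t).neg

theorem core_radius_pos {a r : ℝ} (hr : 0 < r) (har : r < a) (u : ℝ) : 0 < a + r * cos u := by
  nlinarith [neg_one_le_cos u]

theorem unitNormal_torus {a r : ℝ} (hr : 0 < r) (har : r < a) (u v : ℝ) :
    unitNormal (torus a r) u v = ![-(cos u * cos v), -(cos u * sin v), -sin u] := by
  have hf := core_radius_pos hr har u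
  rw [unitNormal, torus_eq_tube, cross_partial_tube (isJet_const r), areaDensity_tube (isJet_const r)]
  have hW : √(jetDet a (cos u) r 0 0) = r * (a + r * cos u) := by
    rw [show jetDet a (cos u) r 0 0 = (r * (a + r * cos u)) ^ 2 by unfold jetDet; ring,
      sqrt_sq (by positivity)]
  rw [hW]
  ext i
  fin_cases i <;> simp <;> field_simp

/-- The unit normal is inward and radial in each meridian disc, so moving by `tΩ` along it shortens
the tube radius by `tΩ`. -/
theorem normalVariation_torus {a r : ℝ} (hr : 0 < r) (har : r < a) (Ω : ℝ → ℝ → ℝ) (t : ℝ) :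
    normalVariation (torus a r) Ω t = tube a fun u v => r - t * Ω u v := by
  funext u v
  rw [normalVariation, unitNormal_torus hr har, torus, tube]
  ext i
  fin_cases i <;> simp <;> ring

end

/-! ### First variation of the geometric quantities at the torus. -/

section

open Real

theorem IsSmoothOnTorus.exists_partialU {Ω : ℝ → ℝ → ℝ} (h : IsSmoothOnTorus Ω) :
    ∃ Ωu, IsSmoothOnTorus Ωu ∧ ∀ u v, HasDerivAt (fun s => Ω s v) (Ωu u v) u := by
  obtain ⟨hs, hpu, hpv⟩ := h
  have hder : ∀ u v, HasDerivAt (fun s => Ω s v)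
      (fderiv ℝ (fun q : ℝ × ℝ => Ω q.1 q.2) (u, v) (1, 0)) u := fun u v =>
    HasFDerivAt.comp_hasDerivAt (f := fun s : ℝ => (s, v)) u
      ((hs.differentiable (by simp)) (u, v)).hasFDerivAt
      ((hasDerivAt_id u).prodMk (hasDerivAt_const u v))
  refine ⟨_, ⟨?_, ?_, ?_⟩, hder⟩
  · exact (hs.fderiv_right (by simp)).clm_apply contDiff_const
  · intro u v
    have h1 := (hder (u + 2 * π) v).comp_add_const u (2 * π)
    simp only [hpu] at h1
    exact h1.unique (hder u v)
  · intro u v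
    have h1 := hder u (v + 2 * π)
    simp only [hpv] at h1
    exact h1.unique (hder u v)

theorem IsSmoothOnTorus.swap {Ω : ℝ → ℝ → ℝ} (h : IsSmoothOnTorus Ω) :
    IsSmoothOnTorus fun u v => Ω v u :=
  ⟨h.1.comp (contDiff_snd.prodMk contDiff_fst), fun u v => h.2.2 v u, fun u v => h.2.1 v u⟩

theorem IsSmoothOnTorus.exists_partialV {Ω : ℝ → ℝ → ℝ} (h : IsSmoothOnTorus Ω) :
    ∃ Ωv, IsSmoothOnTorus Ωv ∧ ∀ u v, HasDerivAt (fun s => Ω u s) (Ωv u v) v := by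
  obtain ⟨Ωv, h1, h2⟩ := h.swap.exists_partialU
  exact ⟨fun u v => Ωv v u, h1.swap, fun u v => h2 v u⟩

section Scalar

variable {a r c s o ou ov ouu ouv ovv : ℝ}

theorem hasDerivAt_radius (r o : ℝ) : HasDerivAt (fun t : ℝ => r - t * o) (-o) 0 := by
  simpa using ((hasDerivAt_id (0 : ℝ)).mul_const o).const_sub r

theorem hasDerivAt_neg_mul (o : ℝ) : HasDerivAt (fun t : ℝ => -(t * o)) (-o) 0 := by
  simpa using hasDerivAt_radius 0 o

theorem hasDerivAt_core (a r c o : ℝ) :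
    HasDerivAt (fun t : ℝ => a + (r - t * o) * c) (-(o * c)) 0 := by
  simpa using ((hasDerivAt_radius r o).mul_const c).const_add a

theorem hasDerivAt_jetDet (a r c o ou ov : ℝ) :
    HasDerivAt (fun t : ℝ => jetDet a c (r - t * o) (-(t * ou)) (-(t * ov)))
      (-(2 * r * (a + r * c) * (a + r * c + r * c) * o)) 0 := by
  have h := (((hasDerivAt_radius r o).pow 2).mul ((hasDerivAt_neg_mul ov).pow 2)).add
    (((hasDerivAt_core a r c o).pow 2).mul
      (((hasDerivAt_neg_mul ou).pow 2).add ((hasDerivAt_radius r o).pow 2)))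
  refine HasDerivAt.congr_deriv h ?_
  simp
  ring

theorem hasDerivAt_jetL (a r c o ou ouu : ℝ) :
    HasDerivAt (fun t : ℝ => jetL a c (r - t * o) (-(t * ou)) (-(t * ouu)))
      (-(c * o * r ^ 2) + (a + r * c) * (r * ouu - 2 * r * o)) 0 := by
  have h := (hasDerivAt_core a r c o).mul ((((hasDerivAt_neg_mul ou).pow 2).const_mul 2).sub
    ((hasDerivAt_radius r o).mul ((hasDerivAt_neg_mul ouu).sub (hasDerivAt_radius r o))))
  refine HasDerivAt.congr_deriv h ?_
  simp
  ring

theorem hasDerivAt_jetM (a r c s o ou ov ouv : ℝ) :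
    HasDerivAt (fun t : ℝ => jetM a c s (r - t * o) (-(t * ou)) (-(t * ov)) (-(t * ouv)))
      (r * (a + r * c) * ouv + r ^ 2 * s * ov) 0 := by
  have h := ((hasDerivAt_core a r c o).mul (((hasDerivAt_neg_mul ou).mul
    (hasDerivAt_neg_mul ov)).sub ((hasDerivAt_radius r o).mul (hasDerivAt_neg_mul ouv)))).add
    (((hasDerivAt_radius r o).mul (hasDerivAt_neg_mul ov)).mul
      (((hasDerivAt_neg_mul ou).mul_const c).sub ((hasDerivAt_radius r o).mul_const s)))
  refine HasDerivAt.congr_deriv h ?_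
  simp
  ring

theorem hasDerivAt_jetN (a r c s o ou ov ovv : ℝ) :
    HasDerivAt (fun t : ℝ => jetN a c s (r - t * o) (-(t * ou)) (-(t * ov)) (-(t * ovv)))
      (-(ou * (a + r * c) ^ 2 * s) - o * (a + r * c) ^ 2 * c - 2 * r * c ^ 2 * (a + r * c) * o
        + r * (a + r * c) * ovv) 0 := by
  have h := ((((hasDerivAt_neg_mul ou).mul ((hasDerivAt_core a r c o).pow 2)).mul_const s).add
    ((((hasDerivAt_radius r o).const_mul 2).mul ((hasDerivAt_neg_mul ov).pow 2)).mul_const c)).sub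
    (((hasDerivAt_radius r o).mul (hasDerivAt_core a r c o)).mul
      ((hasDerivAt_neg_mul ovv).sub ((hasDerivAt_core a r c o).mul_const c)))
  refine HasDerivAt.congr_deriv h ?_
  simp
  ring

theorem hasDerivAt_jetVolume (a r c s o ou : ℝ) :
    HasDerivAt (fun t : ℝ => jetVolume a c s (r - t * o) (-(t * ou)))
      (o * c * ((a * c + r) * r)
        + (a + r * c) * (a * s * ou + o * r + (a * c + r) * o)) 0 := by
  have h := ((hasDerivAt_core a r c o).mul (((hasDerivAt_neg_mul ou).const_mul (a * s)).add
    (((hasDerivAt_radius r o).const_add (a * c)).mul (hasDerivAt_radius r o)))).neg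
  refine HasDerivAt.congr_deriv h ?_
  simp
  ring

theorem sqrt_jetDet_const (hr : 0 < r) (hf : 0 < a + r * c) :
    √(jetDet a c r 0 0) = r * (a + r * c) := by
  rw [show jetDet a c r 0 0 = (r * (a + r * c)) ^ 2 by unfold jetDet; ring,
    sqrt_sq (by positivity)]

theorem hasDerivAt_sqrt_jetDet (hr : 0 < r) (hf : 0 < a + r * c) (o ou ov : ℝ) :
    HasDerivAt (fun t : ℝ => √(jetDet a c (r - t * o) (-(t * ou)) (-(t * ov))))
      (-((a + r * c + r * c) * o)) 0 := by
  have h0 : jetDet a c (r - 0 * o) (-(0 * ou)) (-(0 * ov)) = jetDet a c r 0 0 := by simp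
  have hpos : 0 < jetDet a c r 0 0 := by
    rw [← sqrt_pos, sqrt_jetDet_const hr hf]
    positivity
  refine ((hasDerivAt_jetDet a r c o ou ov).sqrt (by rw [h0]; exact hpos.ne')).congr_deriv ?_
  rw [h0, sqrt_jetDet_const hr hf]
  field_simp

theorem jetMean_const (hr : 0 < r) (hf : 0 < a + r * c) :
    jetMean a c s r 0 0 0 0 0 = (a + r * c + r * c) / (2 * r * (a + r * c)) := by
  rw [jetMean, sqrt_jetDet_const hr hf, jetN, jetM, jetL, jetDet]
  field_simp
  ring

theorem jetGauss_const (hr : 0 < r) (hf : 0 < a + r * c) :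
    jetGauss a c s r 0 0 0 0 0 = c / (r * (a + r * c)) := by
  rw [jetGauss, jetN, jetM, jetL, jetDet]
  field_simp
  ring

/-- The first variation of the mean curvature of the torus. -/
theorem hasDerivAt_jetMean (hr : 0 < r) (hf : 0 < a + r * c) (s o ou ov ouu ouv ovv : ℝ) :
    HasDerivAt (fun t : ℝ => jetMean a c s (r - t * o) (-(t * ou)) (-(t * ov)) (-(t * ouu))
      (-(t * ouv)) (-(t * ovv)))
      (1 / 2 * (ouu / r ^ 2 - s / (r * (a + r * c)) * ou + ovv / (a + r * c) ^ 2)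
        + (2 * ((a + r * c + r * c) / (2 * r * (a + r * c))) ^ 2 - c / (r * (a + r * c))) * o)
      0 := by
  have hnum := (((((hasDerivAt_neg_mul ou).pow 2).add ((hasDerivAt_radius r o).pow 2)).mul
    (hasDerivAt_jetN a r c s o ou ov ovv)).sub ((((hasDerivAt_neg_mul ou).mul
      (hasDerivAt_neg_mul ov)).mul (hasDerivAt_jetM a r c s o ou ov ouv)).const_mul 2)).add
    ((((hasDerivAt_neg_mul ov).pow 2).add ((hasDerivAt_core a r c o).pow 2)).mul
      (hasDerivAt_jetL a r c o ou ouu))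
  have hden := ((hasDerivAt_jetDet a r c o ou ov).const_mul 2).mul
    (hasDerivAt_sqrt_jetDet hr hf o ou ov)
  have hW : jetDet a c r 0 0 = (r * (a + r * c)) ^ 2 := by unfold jetDet; ring
  have hS := sqrt_sq (mul_pos hr hf).le
  refine HasDerivAt.congr_deriv (hnum.div hden ?_) ?_
  · simp only [zero_mul, sub_zero, neg_zero, hW, hS]
    positivity
  · simp only [Pi.mul_apply, Pi.add_apply, Pi.sub_apply, Pi.pow_apply, zero_mul, sub_zero, neg_zero,
      hW, hS, jetL, jetM, jetN]
    -- Eliminating `a` turns the denominator `a + r * c` into an atom `f`, which `field_simp` can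
    -- clear.
    obtain ⟨f, rfl⟩ : ∃ f, a = f - r * c := ⟨a + r * c, by ring⟩
    simp only [sub_add_cancel] at hf ⊢
    field_simp
    ring

/-- The first variation of the Gaussian curvature of the torus. -/
theorem hasDerivAt_jetGauss (hr : 0 < r) (hf : 0 < a + r * c) (s o ou ov ouu ouv ovv : ℝ) :
    HasDerivAt (fun t : ℝ => jetGauss a c s (r - t * o) (-(t * ou)) (-(t * ov)) (-(t * ouu))
      (-(t * ouv)) (-(t * ovv)))
      (c / (a + r * c) * (ouu / r ^ 2)
        + 1 / r * (ovv / (a + r * c) ^ 2 - s / (r * (a + r * c)) * ou)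
        + 2 * ((a + r * c + r * c) / (2 * r * (a + r * c))) * (c / (r * (a + r * c))) * o)
      0 := by
  have hnum := ((hasDerivAt_jetL a r c o ou ouu).mul (hasDerivAt_jetN a r c s o ou ov ovv)).sub
    ((hasDerivAt_jetM a r c s o ou ov ouv).pow 2)
  have hden := (hasDerivAt_jetDet a r c o ou ov).pow 2
  have hW : jetDet a c r 0 0 = (r * (a + r * c)) ^ 2 := by unfold jetDet; ring
  refine HasDerivAt.congr_deriv (hnum.div hden ?_) ?_
  · simp only [zero_mul, sub_zero, neg_zero, hW]
    positivity
  · simp only [Pi.mul_apply, Pi.sub_apply, Pi.pow_apply, zero_mul, sub_zero, neg_zero,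
      hW, jetL, jetM, jetN]
    obtain ⟨f, rfl⟩ : ∃ f, a = f - r * c := ⟨a + r * c, by ring⟩
    simp only [sub_add_cancel] at hf ⊢
    field_simp
    ring

end Scalar

/-- The energy density of a tube in terms of the 2-jet of the radius. -/
def jetEnergy (E : ℝ → ℝ → ℝ) (a c s ρ ρu ρv ρuu ρuv ρvv : ℝ) : ℝ :=
  E (jetMean a c s ρ ρu ρv ρuu ρuv ρvv) (jetGauss a c s ρ ρu ρv ρuu ρuv ρvv)
    * √(jetDet a c ρ ρu ρv)

theorem contDiffAt_jetEnergy {E : ℝ → ℝ → ℝ} (hE : ContDiff ℝ 1 fun q : ℝ × ℝ => E q.1 q.2)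
    {X : Type*} [NormedAddCommGroup X] [NormedSpace ℝ X] (a : ℝ)
    {c s ρ ρu ρv ρuu ρuv ρvv : X → ℝ} {x : X}
    (hc : ContDiffAt ℝ 1 c x) (hs : ContDiffAt ℝ 1 s x) (hρ : ContDiffAt ℝ 1 ρ x)
    (hρu : ContDiffAt ℝ 1 ρu x) (hρv : ContDiffAt ℝ 1 ρv x) (hρuu : ContDiffAt ℝ 1 ρuu x)
    (hρuv : ContDiffAt ℝ 1 ρuv x) (hρvv : ContDiffAt ℝ 1 ρvv x)
    (hW : jetDet a (c x) (ρ x) (ρu x) (ρv x) ≠ 0) :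
    ContDiffAt ℝ 1 (fun y => jetEnergy E a (c y) (s y) (ρ y) (ρu y) (ρv y) (ρuu y) (ρuv y) (ρvv y))
      x := by
  have hdet : ContDiffAt ℝ 1 (fun y => jetDet a (c y) (ρ y) (ρu y) (ρv y)) x := by
    unfold jetDet; fun_prop
  have hsqrt : ContDiffAt ℝ 1 (fun y => √(jetDet a (c y) (ρ y) (ρu y) (ρv y))) x := hdet.sqrt hW
  have hpos : 0 < jetDet a (c x) (ρ x) (ρu x) (ρv x) :=
    lt_of_le_of_ne (by unfold jetDet; positivity) hW.symm
  have hL : ContDiffAt ℝ 1 (fun y => jetL a (c y) (ρ y) (ρu y) (ρuu y)) x := by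
    unfold jetL; fun_prop
  have hM : ContDiffAt ℝ 1 (fun y => jetM a (c y) (s y) (ρ y) (ρu y) (ρv y) (ρuv y)) x := by
    unfold jetM; fun_prop
  have hN : ContDiffAt ℝ 1 (fun y => jetN a (c y) (s y) (ρ y) (ρu y) (ρv y) (ρvv y)) x := by
    unfold jetN; fun_prop
  have hmean : ContDiffAt ℝ 1 (fun y => jetMean a (c y) (s y) (ρ y) (ρu y) (ρv y) (ρuu y) (ρuv y)
      (ρvv y)) x := by
    unfold jetMean
    refine ContDiffAt.div (by fun_prop) (by fun_prop) ?_
    positivity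
  have hgauss : ContDiffAt ℝ 1 (fun y => jetGauss a (c y) (s y) (ρ y) (ρu y) (ρv y) (ρuu y) (ρuv y)
      (ρvv y)) x := by
    unfold jetGauss
    refine ContDiffAt.div (by fun_prop) (by fun_prop) ?_
    positivity
  exact (hE.contDiffAt.comp x (hmean.prodMk hgauss)).mul hsqrt

end

/-! ### Integration by parts and the criterion for criticality. -/

section

open Real Polynomial

/-- The first variation of the energy density at the torus: `P`, `Q`, `e` are the values of
`E_H`, `E_K`, `E`, and `o`, `ou`, `ouu`, `ovv` come from the 2-jet of the variation. -/
def energyVariation (a r c s P Q e o ou ouu ovv : ℝ) : ℝ :=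
  (P * (1 / 2 * (ouu / r ^ 2 - s / (r * (a + r * c)) * ou + ovv / (a + r * c) ^ 2)
      + (2 * ((a + r * c + r * c) / (2 * r * (a + r * c))) ^ 2 - c / (r * (a + r * c))) * o)
    + Q * (c / (a + r * c) * (ouu / r ^ 2)
      + 1 / r * (ovv / (a + r * c) ^ 2 - s / (r * (a + r * c)) * ou)
      + 2 * ((a + r * c + r * c) / (2 * r * (a + r * c))) * (c / (r * (a + r * c))) * o))
    * (r * (a + r * c)) + e * -((a + r * c + r * c) * o)

/-- The first variation of `X · (X_u × X_v)` at the torus. -/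
def volumeVariation (a r c s o ou : ℝ) : ℝ :=
  o * c * ((a * c + r) * r) + (a + r * c) * (a * s * ou + o * r + (a * c + r) * o)

/-- The `u`-component of the flux whose divergence is the first variation. -/
def fluxU (a r p : ℝ) (P Q : ℝ[X]) (u o ou : ℝ) : ℝ :=
  (1 / 2 * P.eval (a + r * cos u)⁻¹ * (a + r * cos u) / r
      + Q.eval (a + r * cos u)⁻¹ * cos u / r) * ou
    - sin u * (fluxPoly a r P Q).eval (a + r * cos u)⁻¹ * o
    - p / 3 * a * (sin u * (a + r * cos u)) * o

/-- The `v`-component of the flux whose divergence is the first variation. -/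
def fluxV (a r : ℝ) (P Q : ℝ[X]) (u ov : ℝ) : ℝ :=
  (1 / 2 * P.eval (a + r * cos u)⁻¹ * r / (a + r * cos u)
      + Q.eval (a + r * cos u)⁻¹ / (a + r * cos u)) * ov

/-- The `u`-derivative of `fluxU`. -/
def fluxUDeriv (a r p : ℝ) (P Q : ℝ[X]) (u o ou ouu : ℝ) : ℝ :=
  let x := (a + r * cos u)⁻¹
  let x' := r * sin u * x ^ 2
  (1 / 2 * ((derivative P).eval x * x' * (a + r * cos u) - P.eval x * (r * sin u)) / r
      + ((derivative Q).eval x * x' * cos u - Q.eval x * sin u) / r) * ou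
    + (1 / 2 * P.eval x * (a + r * cos u) / r + Q.eval x * cos u / r) * ouu
    - (cos u * (fluxPoly a r P Q).eval x
      + (1 - cos u ^ 2) * (derivative (fluxPoly a r P Q)).eval x * (r * x ^ 2)) * o
    - sin u * (fluxPoly a r P Q).eval x * ou
    - p / 3 * a * ((cos u * (a + r * cos u) - r * (1 - cos u ^ 2)) * o
      + sin u * (a + r * cos u) * ou)

variable {a r : ℝ}

theorem hasDerivAt_core_inv (hr : 0 < r) (har : r < a) (u : ℝ) :
    HasDerivAt (fun u => (a + r * cos u)⁻¹) (r * sin u * ((a + r * cos u)⁻¹) ^ 2) u := by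
  have h := (((hasDerivAt_cos u).const_mul r).const_add a).inv (core_radius_pos hr har u).ne'
  refine h.congr_deriv ?_
  simp only [inv_pow]
  ring

theorem hasDerivAt_fluxU (hr : 0 < r) (har : r < a) (p : ℝ) (P Q : ℝ[X]) {o ou : ℝ → ℝ}
    {u ouu : ℝ} (ho : HasDerivAt o (ou u) u) (hou : HasDerivAt ou ouu u) :
    HasDerivAt (fun s => fluxU a r p P Q s (o s) (ou s))
      (fluxUDeriv a r p P Q u (o u) (ou u) ouu) u := by
  have hx := hasDerivAt_core_inv hr har u
  have hf := ((hasDerivAt_cos u).const_mul r).const_add a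
  have hP := (P.hasDerivAt _).comp u hx
  have hQ := (Q.hasDerivAt _).comp u hx
  have hg := ((fluxPoly a r P Q).hasDerivAt _).comp u hx
  have h := ((((((hP.const_mul (1 / 2)).mul hf).div_const r).add
    ((hQ.mul (hasDerivAt_cos u)).div_const r)).mul hou).sub
    (((hasDerivAt_sin u).mul hg).mul ho)).sub
    ((((hasDerivAt_sin u).mul hf).const_mul (p / 3 * a)).mul ho)
  refine HasDerivAt.congr_deriv h ?_
  -- `fluxUDeriv` has `1 - cos²` for `sin²`, which later lets the decomposition be verified by pure
  -- algebra in `cos u`; here it is turned back.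
  simp only [Pi.mul_apply, Pi.add_apply, Function.comp_apply, fluxUDeriv, ← sin_sq u]
  ring

theorem hasDerivAt_fluxV (a r : ℝ) (P Q : ℝ[X]) (u : ℝ) {ov : ℝ → ℝ} {v ovv : ℝ}
    (hov : HasDerivAt ov ovv v) :
    HasDerivAt (fun s => fluxV a r P Q u (ov s)) (fluxV a r P Q u ovv) v :=
  hov.const_mul _

theorem meanPoly_eval_inv {c : ℝ} (hr : r ≠ 0) (hf : a + r * c ≠ 0) :
    (meanPoly a r).eval (a + r * c)⁻¹ = (a + r * c + r * c) / (2 * r * (a + r * c)) := by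
  simp only [meanPoly, eval_sub, eval_mul, eval_C, eval_X]
  field_simp
  ring

theorem gaussPoly_eval_inv {c : ℝ} (hr : r ≠ 0) (hf : a + r * c ≠ 0) :
    (gaussPoly a r).eval (a + r * c)⁻¹ = c / (r * (a + r * c)) := by
  simp only [gaussPoly, eval_sub, eval_mul, eval_C, eval_X]
  field_simp
  ring

/-- The first variation is a divergence plus the Euler–Lagrange expression. -/
theorem energyVariation_eq (hr : 0 < r) (har : r < a) (p : ℝ) (P Q e : ℝ[X])
    (u o ou ouu ovv : ℝ) :
    energyVariation a r (cos u) (sin u) (P.eval (a + r * cos u)⁻¹) (Q.eval (a + r * cos u)⁻¹)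
        (e.eval (a + r * cos u)⁻¹) o ou ouu ovv
      - p * (1 / 3 * volumeVariation a r (cos u) (sin u) o ou)
      = fluxUDeriv a r p P Q u o ou ouu + fluxV a r P Q u ovv
        + r * (a + r * cos u) * o
          * ((eulerLagrange a r (P, Q, e)).eval (a + r * cos u)⁻¹ - p) := by
  have hf := core_radius_pos hr har u
  -- If `A` is the coefficient of `ouu`, then `A'` minus the coefficient of `ou` is `sin u` times
  -- `fluxPoly`, because the undifferentiated `P` and `Q` cancel. The second integration by parts
  -- then yields `divPoly`. The volume part is `3 r f o` plus the `u`-derivative of `a sin u f o`.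
  simp only [energyVariation, volumeVariation, fluxUDeriv, fluxV, eval_eulerLagrange, fluxPoly,
    derivative_add, derivative_sub, derivative_mul, derivative_C, derivative_X, derivative_one,
    eval_add, eval_sub, eval_mul, eval_C, eval_X, eval_one, eval_zero]
  generalize P.eval (a + r * cos u)⁻¹ = P₀
  generalize Q.eval (a + r * cos u)⁻¹ = Q₀
  generalize e.eval (a + r * cos u)⁻¹ = e₀
  generalize (derivative P).eval (a + r * cos u)⁻¹ = P₁
  generalize (derivative Q).eval (a + r * cos u)⁻¹ = Q₁
  generalize (derivative (derivative P)).eval (a + r * cos u)⁻¹ = P₂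
  generalize (derivative (derivative Q)).eval (a + r * cos u)⁻¹ = Q₂
  generalize cos u = c at *
  obtain ⟨f, rfl⟩ : ∃ f, a = f - r * c := ⟨a + r * c, by ring⟩
  simp only [sub_add_cancel] at hf ⊢
  field_simp
  ring

theorem continuous_eval_core_inv (hr : 0 < r) (har : r < a) (P : ℝ[X]) :
    Continuous fun q : ℝ × ℝ => P.eval (a + r * cos q.1)⁻¹ := by
  have h : Continuous fun q : ℝ × ℝ => (a + r * cos q.1)⁻¹ :=
    Continuous.inv₀ (by fun_prop) fun q => (core_radius_pos hr har q.1).ne'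
  exact P.continuous.comp h

theorem continuous_fluxUDeriv (hr : 0 < r) (har : r < a) (p : ℝ) (P Q : ℝ[X])
    {o ou ouu : ℝ → ℝ → ℝ} (ho : Continuous fun q : ℝ × ℝ => o q.1 q.2)
    (hou : Continuous fun q : ℝ × ℝ => ou q.1 q.2)
    (houu : Continuous fun q : ℝ × ℝ => ouu q.1 q.2) :
    Continuous fun q : ℝ × ℝ =>
      fluxUDeriv a r p P Q q.1 (o q.1 q.2) (ou q.1 q.2) (ouu q.1 q.2) := by
  have h1 := continuous_eval_core_inv hr har P
  have h2 := continuous_eval_core_inv hr har Q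
  have h3 := continuous_eval_core_inv hr har (derivative P)
  have h4 := continuous_eval_core_inv hr har (derivative Q)
  have h5 := continuous_eval_core_inv hr har (fluxPoly a r P Q)
  have h6 := continuous_eval_core_inv hr har (derivative (fluxPoly a r P Q))
  have h7 : Continuous fun q : ℝ × ℝ => (a + r * cos q.1)⁻¹ := by
    simpa using continuous_eval_core_inv hr har X
  unfold fluxUDeriv
  dsimp only
  fun_prop

theorem continuous_fluxV (hr : 0 < r) (har : r < a) (P Q : ℝ[X]) {ov : ℝ → ℝ → ℝ}
    (hov : Continuous fun q : ℝ × ℝ => ov q.1 q.2) :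
    Continuous fun q : ℝ × ℝ => fluxV a r P Q q.1 (ov q.1 q.2) := by
  have h1 := continuous_eval_core_inv hr har P
  have h2 := continuous_eval_core_inv hr har Q
  have h7 : Continuous fun q : ℝ × ℝ => (a + r * cos q.1)⁻¹ := by
    simpa using continuous_eval_core_inv hr har X
  unfold fluxV
  simp only [div_eq_mul_inv]
  fun_prop

/-- The inward normal makes the flux of the position vector negative. So the absolute value in the
volume is smooth at the torus and acts there as a change of sign, which is why the equation reads
`EL = p`. -/
theorem integral_jetVolume_const_neg (hr : 0 < r) (har : r < a) :
    (1 / 3 : ℝ) * ∫ u in (0 : ℝ)..(2 * π), ∫ _v in (0 : ℝ)..(2 * π),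
      jetVolume a (cos u) (sin u) r 0 < 0 := by
  have h : ∀ u : ℝ, ∫ _v in (0 : ℝ)..(2 * π), jetVolume a (cos u) (sin u) r 0
      = -(2 * π * r) * ((a ^ 2 + r ^ 2) * cos u + (a * r * cos u ^ 2 + a * r)) := by
    intro u
    rw [intervalIntegral.integral_const, jetVolume, smul_eq_mul]
    ring
  have hi : ∫ u in (0 : ℝ)..(2 * π), ((a ^ 2 + r ^ 2) * cos u + (a * r * cos u ^ 2 + a * r))
      = 3 * π * (a * r) := by
    rw [intervalIntegral.integral_add, intervalIntegral.integral_add,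
      intervalIntegral.integral_const_mul, intervalIntegral.integral_const_mul, integral_cos,
      integral_cos_sq, intervalIntegral.integral_const]
    · simp
      ring
    all_goals exact Continuous.intervalIntegrable (by fun_prop) _ _
  simp only [h]
  rw [intervalIntegral.integral_const_mul, hi]
  have : 0 < a := hr.trans har
  have : 0 < π := pi_pos
  have : 0 < 2 * π * r * (3 * π * (a * r)) := by positivity
  linarith

theorem integral_box_add {L : ℝ} (hL : 0 ≤ L) {f g : ℝ → ℝ → ℝ}
    (hf : Continuous fun q : ℝ × ℝ => f q.1 q.2) (hg : Continuous fun q : ℝ × ℝ => g q.1 q.2) :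
    ∫ u in (0 : ℝ)..L, ∫ v in (0 : ℝ)..L, (f u v + g u v)
      = (∫ u in (0 : ℝ)..L, ∫ v in (0 : ℝ)..L, f u v)
        + ∫ u in (0 : ℝ)..L, ∫ v in (0 : ℝ)..L, g u v := by
  have hc : IsCompact (Set.Icc 0 L ×ˢ Set.Icc 0 L) := isCompact_Icc.prod isCompact_Icc
  rw [integral_box_eq_setIntegral hL (f := fun q => f q.1 q.2) hf.continuousOn,
    integral_box_eq_setIntegral hL (f := fun q => g q.1 q.2) hg.continuousOn,
    integral_box_eq_setIntegral hL (f := fun q => f q.1 q.2 + g q.1 q.2) (hf.add hg).continuousOn]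
  exact MeasureTheory.integral_add (hf.continuousOn.integrableOn_compact hc)
    (hg.continuousOn.integrableOn_compact hc)

/-- A torus whose Euler–Lagrange expression is the constant pressure `p` is critical. -/
theorem isCriticalPoint_torus (hr : 0 < r) (har : r < a) {E : ℝ → ℝ → ℝ} {P Q e : ℝ[X]} {p : ℝ}
    (hE : ContDiff ℝ 1 fun q : ℝ × ℝ => E q.1 q.2)
    (hd : ∀ x : ℝ, HasFDerivAt (fun q : ℝ × ℝ => E q.1 q.2)
      (P.eval x • ContinuousLinearMap.fst ℝ ℝ ℝ + Q.eval x • ContinuousLinearMap.snd ℝ ℝ ℝ)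
      ((meanPoly a r).eval x, (gaussPoly a r).eval x))
    (he : ∀ x : ℝ, E ((meanPoly a r).eval x) ((gaussPoly a r).eval x) = e.eval x)
    (hEL : eulerLagrange a r (P, Q, e) = C p) :
    IsCriticalPoint (shapeFunctional E p) (torus a r) := by
  intro Ω hΩ
  obtain ⟨Ωu, hsu, hΩu⟩ := hΩ.exists_partialU
  obtain ⟨Ωv, hsv, hΩv⟩ := hΩ.exists_partialV
  obtain ⟨Ωuu, hsuu, hΩuu⟩ := hsu.exists_partialU
  obtain ⟨Ωuv, hsuv, hΩuv⟩ := hsu.exists_partialV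
  obtain ⟨Ωvv, hsvv, hΩvv⟩ := hsv.exists_partialV
  have hjet : IsJet Ω Ωu Ωv Ωuu Ωuv Ωvv := ⟨hΩu, hΩv, hΩuu, hΩuv, hΩvv⟩
  have hlift : ∀ {F : ℝ → ℝ → ℝ}, IsSmoothOnTorus F →
      ContDiff ℝ 1 fun x : ℝ × ℝ × ℝ => F x.2.1 x.2.2 := fun hF =>
    (hF.1.of_le (by simp)).comp contDiff_snd
  have c0 := hlift hΩ
  have cu := hlift hsu
  have cv := hlift hsv
  have cuu := hlift hsuu
  have cuv := hlift hsuv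
  have cvv := hlift hsvv
  have hπ : (0 : ℝ) ≤ 2 * π := by positivity
  have henergy : HasDerivAt (fun t => curvatureEnergy E (normalVariation (torus a r) Ω t))
      (∫ u in (0 : ℝ)..(2 * π), ∫ v in (0 : ℝ)..(2 * π),
        energyVariation a r (cos u) (sin u) (P.eval (a + r * cos u)⁻¹)
          (Q.eval (a + r * cos u)⁻¹) (e.eval (a + r * cos u)⁻¹) (Ω u v) (Ωu u v) (Ωuu u v)
          (Ωvv u v)) 0 := by
    have h := hasDerivAt_integral_box hπ
      (g := fun x => jetEnergy E a (cos x.2.1) (sin x.2.1) (r - x.1 * Ω x.2.1 x.2.2)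
        (-(x.1 * Ωu x.2.1 x.2.2)) (-(x.1 * Ωv x.2.1 x.2.2)) (-(x.1 * Ωuu x.2.1 x.2.2))
        (-(x.1 * Ωuv x.2.1 x.2.2)) (-(x.1 * Ωvv x.2.1 x.2.2)))
      (g' := fun u v => energyVariation a r (cos u) (sin u) (P.eval (a + r * cos u)⁻¹)
          (Q.eval (a + r * cos u)⁻¹) (e.eval (a + r * cos u)⁻¹) (Ω u v) (Ωu u v) (Ωuu u v)
          (Ωvv u v)) ?_ ?_
    · refine h.congr_of_eventuallyEq (Filter.Eventually.of_forall fun t => ?_)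
      have hj := hjet.const_sub_mul r t
      simp only [curvatureEnergy, normalVariation_torus hr har, meanCurvature_tube hj,
        gaussCurvature_tube hj, areaDensity_tube hj, jetEnergy]
    · intro u v
      refine contDiffAt_jetEnergy hE a ?_ ?_ ?_ ?_ ?_ ?_ ?_ ?_ ?_
      · exact ContDiff.contDiffAt (by fun_prop)
      · exact ContDiff.contDiffAt (by fun_prop)
      · exact (contDiff_const.sub (contDiff_fst.mul c0)).contDiffAt
      · exact (contDiff_fst.mul cu).neg.contDiffAt
      · exact (contDiff_fst.mul cv).neg.contDiffAt
      · exact (contDiff_fst.mul cuu).neg.contDiffAt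
      · exact (contDiff_fst.mul cuv).neg.contDiffAt
      · exact (contDiff_fst.mul cvv).neg.contDiffAt
      have hf := core_radius_pos hr har u
      simp only [zero_mul, sub_zero, neg_zero, jetDet]
      positivity
    · intro u v
      have hf := core_radius_pos hr har u
      have hH := hasDerivAt_jetMean hr hf (sin u) (Ω u v) (Ωu u v) (Ωv u v) (Ωuu u v) (Ωuv u v)
        (Ωvv u v)
      have hK := hasDerivAt_jetGauss hr hf (sin u) (Ω u v) (Ωu u v) (Ωv u v) (Ωuu u v) (Ωuv u v)
        (Ωvv u v)
      have hW := hasDerivAt_sqrt_jetDet hr hf (Ω u v) (Ωu u v) (Ωv u v)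
      have hE' := HasFDerivAt.comp_hasDerivAt_of_eq (0 : ℝ) (hd (a + r * cos u)⁻¹)
        (hH.prodMk hK) (by
          simp only [zero_mul, sub_zero, neg_zero, jetMean_const hr hf, jetGauss_const hr hf,
            meanPoly_eval_inv hr.ne' hf.ne', gaussPoly_eval_inv hr.ne' hf.ne'])
      refine HasDerivAt.congr_deriv (hE'.mul hW) ?_
      simp only [Function.comp_apply, zero_mul, sub_zero, neg_zero, sqrt_jetDet_const hr hf,
        jetMean_const hr hf, jetGauss_const hr hf, ← he, meanPoly_eval_inv hr.ne' hf.ne',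
        gaussPoly_eval_inv hr.ne' hf.ne', energyVariation]
      simp
  have hvol : HasDerivAt (fun t => enclosedVolume (normalVariation (torus a r) Ω t))
      (-(1 / 3 * ∫ u in (0 : ℝ)..(2 * π), ∫ v in (0 : ℝ)..(2 * π),
        volumeVariation a r (cos u) (sin u) (Ω u v) (Ωu u v))) 0 := by
    have hcos : ContDiff ℝ 1 fun x : ℝ × ℝ × ℝ => cos x.2.1 := by fun_prop
    have hsin : ContDiff ℝ 1 fun x : ℝ × ℝ × ℝ => sin x.2.1 := by fun_prop
    have hρ : ContDiff ℝ 1 fun x : ℝ × ℝ × ℝ => r - x.1 * Ω x.2.1 x.2.2 :=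
      contDiff_const.sub (contDiff_fst.mul c0)
    have h := hasDerivAt_integral_box hπ
      (g := fun x => jetVolume a (cos x.2.1) (sin x.2.1) (r - x.1 * Ω x.2.1 x.2.2)
        (-(x.1 * Ωu x.2.1 x.2.2)))
      (g' := fun u v => volumeVariation a r (cos u) (sin u) (Ω u v) (Ωu u v))
      (fun u v => ((contDiff_const.add (hρ.mul hcos)).mul
        (((contDiff_const.mul hsin).mul (contDiff_fst.mul cu).neg).add
          (((contDiff_const.mul hcos).add hρ).mul hρ))).neg.contDiffAt)
      (fun u v => hasDerivAt_jetVolume a r (cos u) (sin u) (Ω u v) (Ωu u v))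
    have hneg := integral_jetVolume_const_neg hr har
    have habs := (hasDerivAt_abs_neg hneg).comp_of_eq (0 : ℝ) (h.const_mul (1 / 3)) (by simp)
    refine (habs.congr_of_eventuallyEq (Filter.Eventually.of_forall fun t => ?_)).congr_deriv
      (by ring)
    have hj := hjet.const_sub_mul r t
    simp only [enclosedVolume, normalVariation_torus hr har, tube_dotProduct_cross hj,
      Function.comp_apply]
  refine (henergy.add (hvol.const_mul p)).congr_deriv ?_
  -- The hypothesis `hEL` cancels the undifferentiated remainder: only a divergence and the volume
  -- term are left, and the latter is offset by the variation of `p` times the volume.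
  have hdecomp : ∀ u v, energyVariation a r (cos u) (sin u) (P.eval (a + r * cos u)⁻¹)
      (Q.eval (a + r * cos u)⁻¹) (e.eval (a + r * cos u)⁻¹) (Ω u v) (Ωu u v) (Ωuu u v) (Ωvv u v)
      = fluxUDeriv a r p P Q u (Ω u v) (Ωu u v) (Ωuu u v) + fluxV a r P Q u (Ωvv u v)
        + p / 3 * volumeVariation a r (cos u) (sin u) (Ω u v) (Ωu u v) := by
    intro u v
    have h := energyVariation_eq hr har p P Q e u (Ω u v) (Ωu u v) (Ωuu u v) (Ωvv u v)
    rw [hEL, eval_C, sub_self, mul_zero, add_zero] at h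
    rw [← h]
    ring
  have k0 := hΩ.1.continuous
  have ku := hsu.1.continuous
  have hUc := continuous_fluxUDeriv hr har p P Q k0 ku hsuu.1.continuous
  have hVc := continuous_fluxV hr har P Q hsvv.1.continuous
  have hvolc : Continuous fun q : ℝ × ℝ =>
      p / 3 * volumeVariation a r (cos q.1) (sin q.1) (Ω q.1 q.2) (Ωu q.1 q.2) := by
    unfold volumeVariation
    fun_prop
  have hdiv := integral_divergence_eq_zero hπ
    (U := fun u v => fluxU a r p P Q u (Ω u v) (Ωu u v)) (V := fun u v => fluxV a r P Q u (Ωv u v))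
    (fun u v => hasDerivAt_fluxU hr har p P Q (o := fun s => Ω s v) (hΩu u v) (hΩuu u v))
    (fun u v => hasDerivAt_fluxV a r P Q u (hΩvv u v)) hUc hVc
    (fun v => by
      have h1 := hΩ.2.1 0 v
      have h2 := hsu.2.1 0 v
      rw [zero_add] at h1 h2
      simp [fluxU, h1, h2])
    (fun u => by
      have h1 := hsv.2.2 u 0
      rw [zero_add] at h1
      rw [h1])
  simp only [hdecomp]
  rw [integral_box_add hπ (hUc.add hVc) hvolc, hdiv]
  simp only [intervalIntegral.integral_const_mul]
  ring

end

/-! ### Linear dependence on the coefficients and elimination of degrees. -/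

section

open Polynomial

/-- Along the torus, the derivatives `E_H`, `E_K` and the values of the Lagrange function `E` are
the polynomials in `w` given by the components of `j`. -/
structure HasTorusJet (a r : ℝ) (E : ℝ → ℝ → ℝ) (j : ℝ[X] × ℝ[X] × ℝ[X]) : Prop where
  contDiff : ContDiff ℝ 1 fun q : ℝ × ℝ => E q.1 q.2
  hasFDerivAt : ∀ x : ℝ, HasFDerivAt (fun q : ℝ × ℝ => E q.1 q.2)
    (j.1.eval x • ContinuousLinearMap.fst ℝ ℝ ℝ + j.2.1.eval x • ContinuousLinearMap.snd ℝ ℝ ℝ)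
    ((meanPoly a r).eval x, (gaussPoly a r).eval x)
  eval_eq : ∀ x : ℝ, E ((meanPoly a r).eval x) ((gaussPoly a r).eval x) = j.2.2.eval x

namespace HasTorusJet

variable {a r : ℝ} {E F : ℝ → ℝ → ℝ} {j l : ℝ[X] × ℝ[X] × ℝ[X]}

theorem add (hE : HasTorusJet a r E j) (hF : HasTorusJet a r F l) :
    HasTorusJet a r (fun H K => E H K + F H K) (j + l) where
  contDiff := hE.contDiff.add hF.contDiff
  hasFDerivAt x := by
    refine ((hE.hasFDerivAt x).add (hF.hasFDerivAt x)).congr_fderiv ?_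
    simp only [Prod.fst_add, Prod.snd_add, eval_add]
    module
  eval_eq x := by simp [hE.eval_eq, hF.eval_eq]

theorem const_mul (hE : HasTorusJet a r E j) (c : ℝ) :
    HasTorusJet a r (fun H K => c * E H K) (c • j) where
  contDiff := contDiff_const.mul hE.contDiff
  hasFDerivAt x := by
    refine ((hE.hasFDerivAt x).const_mul c).congr_fderiv ?_
    simp only [Prod.smul_fst, Prod.smul_snd, eval_smul, smul_eq_mul]
    module
  eval_eq x := by simp [hE.eval_eq]

theorem zero : HasTorusJet a r (fun _ _ => 0) 0 where
  contDiff := contDiff_const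
  hasFDerivAt x := by simpa using hasFDerivAt_const (0 : ℝ) _
  eval_eq x := by simp

theorem sum {ι : Type*} (s : Finset ι) {E : ι → ℝ → ℝ → ℝ} {j : ι → ℝ[X] × ℝ[X] × ℝ[X]}
    (h : ∀ i ∈ s, HasTorusJet a r (E i) (j i)) :
    HasTorusJet a r (fun H K => ∑ i ∈ s, E i H K) (∑ i ∈ s, j i) := by
  classical
  induction s using Finset.induction_on with
  | empty => simpa using zero
  | insert i s hi ih =>
    simp only [Finset.sum_insert hi]
    exact (h i (Finset.mem_insert_self i s)).add
      (ih fun i' hi' => h i' (Finset.mem_insert_of_mem hi'))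

theorem monomial (a r : ℝ) (k m : ℕ) :
    HasTorusJet a r (fun H K => H ^ k * K ^ m) (monomialJet a r k m) where
  contDiff := by fun_prop
  hasFDerivAt x := by
    refine ((hasFDerivAt_fst.pow k).mul (hasFDerivAt_snd.pow m)).congr_fderiv ?_
    ext <;> simp [monomialJet] <;> ring
  eval_eq x := by simp [monomialJet]

end HasTorusJet

/-- The Euler–Lagrange expression of `lagrangeFunction n α β`, without the pressure term. -/
def totalEL (a r : ℝ) (n : ℕ) (α : ℕ → ℝ) (β : ℕ → ℕ → ℝ) : ℝ[X] :=
  (∑ k ∈ Finset.range (n + 1), α k • monomialEL a r k 0)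
    + ∑ m ∈ Finset.Icc 1 (n / 2), ∑ k ∈ Finset.Icc 1 (n - 2 * m), β m k • monomialEL a r k m

/-- The passage from analysis to algebra: jets along the torus add up monomial by monomial, and
`eulerLagrange` is linear in them. -/
theorem isCriticalPoint_of_totalEL_eq {a r : ℝ} (hr : 0 < r) (har : r < a) {n : ℕ} {α : ℕ → ℝ}
    {β : ℕ → ℕ → ℝ} {p : ℝ} (h : totalEL a r n α β = C p) :
    IsCriticalPoint (shapeFunctional (lagrangeFunction n α β) p) (torus a r) := by
  have hjet := (HasTorusJet.sum (Finset.range (n + 1))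
    fun k _ => (HasTorusJet.monomial a r k 0).const_mul (α k)).add
    (HasTorusJet.sum (Finset.Icc 1 (n / 2)) fun m _ =>
      HasTorusJet.sum (Finset.Icc 1 (n - 2 * m)) fun k _ =>
        (HasTorusJet.monomial a r k m).const_mul (β m k))
  have hfun : lagrangeFunction n α β = fun H K =>
      (∑ k ∈ Finset.range (n + 1), α k * (H ^ k * K ^ 0))
        + ∑ m ∈ Finset.Icc 1 (n / 2), ∑ k ∈ Finset.Icc 1 (n - 2 * m), β m k * (H ^ k * K ^ m) := by
    funext H K
    simp only [lagrangeFunction, pow_zero, mul_one, Finset.mul_sum]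
    congr 1
    exact Finset.sum_congr rfl fun m _ => Finset.sum_congr rfl fun k _ => by ring
  rw [hfun]
  refine isCriticalPoint_torus hr har hjet.contDiff hjet.hasFDerivAt hjet.eval_eq ?_
  rw [← h, totalEL]
  simp only [Prod.mk.eta, map_add, map_sum, map_smul, monomialEL]

theorem totalEL_add (a r : ℝ) (n : ℕ) (α α' : ℕ → ℝ) (β β' : ℕ → ℕ → ℝ) :
    totalEL a r n (α + α') (β + β') = totalEL a r n α β + totalEL a r n α' β' := by
  simp only [totalEL, Pi.add_apply, add_smul, Finset.sum_add_distrib]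
  abel

theorem totalEL_single_zero (a r : ℝ) {n k : ℕ} (hk : k ≤ n) (x : ℝ) :
    totalEL a r n (Pi.single k x) 0 = x • monomialEL a r k 0 := by
  rw [totalEL, Finset.sum_eq_single_of_mem k (Finset.mem_range.2 (by omega))]
  · simp
  · intro i _ hi
    simp [hi]

theorem totalEL_zero_single (a r : ℝ) {n : ℕ} (hn : 2 ≤ n) (b : ℕ → ℝ) :
    totalEL a r n 0 (Pi.single 1 b) = ∑ k ∈ Finset.Icc 1 (n - 2), b k • monomialEL a r k 1 := by
  rw [totalEL, Finset.sum_eq_single_of_mem (s := Finset.Icc 1 (n / 2)) 1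
    (Finset.mem_Icc.2 (by omega))]
  · simp
  · intro i _ hi
    simp [hi]

theorem coeff_two_totalEL {a r : ℝ} (hr : r ≠ 0) (n : ℕ) (α : ℕ → ℝ) (β : ℕ → ℕ → ℝ) :
    (totalEL a r n α β).coeff 2 = 0 := by
  simp [totalEL, coeff_two_monomialEL hr]

/-- `H^k` contributes degree at most `k + 1 ≤ n + 1`. For `m ≥ 1` the bound is `k + m + 2`, and `k ≤
n - 2m` brings it down to `n - m + 2 ≤ n + 1`. -/
theorem natDegree_totalEL_le (a r : ℝ) (n : ℕ) (α : ℕ → ℝ) (β : ℕ → ℕ → ℝ) :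
    (totalEL a r n α β).natDegree ≤ n + 1 := by
  refine natDegree_add_le_of_degree_le (natDegree_sum_le_of_forall_le _ _ fun k hk => ?_)
    (natDegree_sum_le_of_forall_le _ _ fun m hm => natDegree_sum_le_of_forall_le _ _ fun k hk => ?_)
  · have := Finset.mem_range.1 hk
    exact (natDegree_smul_le _ _).trans ((natDegree_monomialEL_zero_le a r k).trans (by omega))
  · have h1 := Finset.mem_Icc.1 hm
    have h2 := Finset.mem_Icc.1 hk
    exact (natDegree_smul_le _ _).trans
      ((natDegree_monomialEL_le a r h2.1 h1.1).trans (by omega))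

/-- Suitable coefficients of `1` and `K * H ^ k` and a suitable pressure bring the Euler–Lagrange
expression to the form `x * w ^ 3`. -/
theorem exists_totalEL_eq_cubic {a r : ℝ} (hr : 0 < r) (har : r < a) {n : ℕ} (hn : 2 ≤ n)
    (α : ℕ → ℝ) (β : ℕ → ℕ → ℝ) : ∃ (y : ℝ) (b : ℕ → ℝ) (p x : ℝ),
      totalEL a r n (α + Pi.single 0 y) (β + Pi.single 1 b) = C p + C x * X ^ 3 := by
  obtain ⟨b, hb⟩ := exists_natDegree_add_sum_monomialEL_le hr har (n - 2) (totalEL a r n α β)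
    ((natDegree_totalEL_le a r n α β).trans (by omega))
  rw [← totalEL_zero_single a r hn, ← totalEL_add] at hb
  set q := totalEL a r n (α + 0) (β + Pi.single 1 b) with hq
  have hcubic := eq_cubic_of_coeff_two_eq_zero hb (coeff_two_totalEL hr.ne' _ _ _)
  -- The function `1` contributes `-2/r + (a/r) w`. This multiple cancels the linear term and adds
  -- `2 * q.coeff 1 / a` to the constant, which becomes the pressure.
  refine ⟨-(q.coeff 1 * r / a), b, q.coeff 0 + 2 * q.coeff 1 / a, q.coeff 3, ?_⟩
  have hsplit : totalEL a r n (α + Pi.single 0 (-(q.coeff 1 * r / a))) (β + Pi.single 1 b)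
      = q + (-(q.coeff 1 * r / a)) • monomialEL a r 0 0 := by
    rw [hq, ← totalEL_single_zero a r (Nat.zero_le n), ← totalEL_add, add_zero, add_zero]
  have ha : a ≠ 0 := (hr.trans har).ne'
  have hr' : r ≠ 0 := hr.ne'
  rw [hsplit, monomialEL_zero_zero]
  have hev : ∀ z, q.eval z = q.coeff 0 + q.coeff 1 * z + q.coeff 3 * z ^ 3 := by
    intro z
    conv_lhs => rw [hcubic]
    simp
  refine Polynomial.funext fun z => ?_
  simp only [hev, eval_add, eval_smul, eval_mul, eval_C, eval_X, eval_pow, smul_eq_mul]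
  field_simp
  ring

/-! ### Removing the cubic term and choosing the coefficients. -/

theorem exists_isCriticalPoint_of_ne {a r : ℝ} (hr : 0 < r) (har : r < a) {n : ℕ} (hn : 3 ≤ n)
    (hne : a ^ 2 ≠ 2 * r ^ 2) (α₀ : ℕ → ℝ) (β₀ : ℕ → ℕ → ℝ) :
    ∃ (α : ℕ → ℝ) (β : ℕ → ℕ → ℝ) (p : ℝ),
      (∀ k, k ≠ 0 → k ≠ 2 → α k = α₀ k) ∧ (∀ m k, m ≠ 1 → β m k = β₀ m k) ∧
      IsCriticalPoint (shapeFunctional (lagrangeFunction n α β) p) (torus a r) := by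
  obtain ⟨y, b, p, x, h⟩ := exists_totalEL_eq_cubic hr har (by omega : 2 ≤ n) α₀ β₀
  set c : ℝ := a * (a ^ 2 - 2 * r ^ 2) / (4 * r ^ 3) with hc
  have ha : a ≠ 0 := (hr.trans har).ne'
  have hr' : r ≠ 0 := hr.ne'
  have hc0 : c ≠ 0 := by
    rw [hc]
    have := sub_ne_zero.2 hne
    positivity
  -- `H²` contributes `c w³`, so `-(x / c)` cancels the residual `x w³`; among the `α`, only indices
  -- `0` and `2` are changed.
  refine ⟨α₀ + Pi.single 0 y + Pi.single 2 (-(x / c)), β₀ + Pi.single 1 b + 0, p, ?_, ?_,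
    isCriticalPoint_of_totalEL_eq hr har ?_⟩
  · intro k h0 h2
    simp [h0, h2]
  · intro m k hm
    simp [hm]
  · rw [totalEL_add, h, totalEL_single_zero a r (by omega), monomialEL_two_zero hr', ← hc]
    refine Polynomial.funext fun z => ?_
    simp only [eval_add, eval_smul, eval_mul, eval_C, eval_X, eval_pow, smul_eq_mul]
    field_simp
    ring

/-- The cubic term is cancelled by a multiple of `H³ - HK`. Since `n ≥ 4`, the correction of `α 3`
does not affect the prescribed `α n`. -/
theorem exists_isCriticalPoint_of_eq {a r : ℝ} (hr : 0 < r) (har : r < a) {n : ℕ} (hn : 4 ≤ n)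
    (heq : a ^ 2 = 2 * r ^ 2) (c : ℝ) :
    ∃ (α : ℕ → ℝ) (β : ℕ → ℕ → ℝ) (p : ℝ), α n = c ∧
      IsCriticalPoint (shapeFunctional (lagrangeFunction n α β) p) (torus a r) := by
  obtain ⟨y, b, p, x, h⟩ := exists_totalEL_eq_cubic hr har (by omega : 2 ≤ n) (Pi.single n c) 0
  have ha : a ≠ 0 := (hr.trans har).ne'
  have hr' : r ≠ 0 := hr.ne'
  obtain ⟨z, hz⟩ : ∃ z : ℝ, z = -(x / (a / (2 * r ^ 2))) := ⟨_, rfl⟩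
  refine ⟨Pi.single n c + Pi.single 0 y + (Pi.single 3 z + 0),
    0 + Pi.single 1 b + (0 + Pi.single 1 (Pi.single 1 (-z))), p, ?_,
    isCriticalPoint_of_totalEL_eq hr har ?_⟩
  · have h0 : n ≠ 0 := by omega
    have h3 : n ≠ 3 := by omega
    simp [h0, h3]
  · have h1 : ∑ k ∈ Finset.Icc 1 (n - 2), (Pi.single 1 (-z) : ℕ → ℝ) k • monomialEL a r k 1
        = (-z) • monomialEL a r 1 1 := by
      rw [Finset.sum_eq_single_of_mem 1 (Finset.mem_Icc.2 (by omega))]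
      · simp
      · intro i _ hi
        simp [hi]
    rw [totalEL_add, h, totalEL_add, totalEL_single_zero a r (by omega),
      totalEL_zero_single a r (by omega), h1, neg_smul, ← sub_eq_add_neg, ← smul_sub,
      monomialEL_three_zero_sub hr' heq]
    refine Polynomial.funext fun w => ?_
    simp only [eval_add, eval_smul, eval_mul, eval_C, eval_X, eval_pow, smul_eq_mul, hz]
    field_simp
    ring

theorem exists_isCriticalPoint_one {a r : ℝ} (hr : 0 < r) (har : r < a) (c : ℝ) :
    ∃ (α : ℕ → ℝ) (β : ℕ → ℕ → ℝ) (p : ℝ), α 1 = c ∧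
      IsCriticalPoint (shapeFunctional (lagrangeFunction 1 α β) p) (torus a r) := by
  have hr' : r ≠ 0 := hr.ne'
  -- The contribution of `H` has linear coefficient `a/r²` and that of `1` has `a/r`, so `cH - c/r`
  -- has none; the constants `-c/r²` and `2c/r²` leave the pressure `c/r²`.
  refine ⟨Pi.single 1 c + Pi.single 0 (-(c / r)), 0 + 0, c / r ^ 2, by simp,
    isCriticalPoint_of_totalEL_eq hr har ?_⟩
  rw [totalEL_add, totalEL_single_zero a r le_rfl, totalEL_single_zero a r (Nat.zero_le 1),
    monomialEL_one_zero hr', monomialEL_zero_zero]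
  refine Polynomial.funext fun w => ?_
  simp only [eval_add, eval_smul, eval_mul, eval_C, eval_X, smul_eq_mul]
  field_simp
  ring

end

end TorusCritical

end

theorem theorem2 (a r : ℝ) (hr : 0 < r) (har : r < a) (n : ℕ) :
    (1 ≤ n → n ≠ 2 → (n = 3 → a ^ 2 ≠ 2 * r ^ 2) →
      ∀ c : ℝ, ∃ (α : ℕ → ℝ) (β : ℕ → ℕ → ℝ) (p : ℝ), α n = c ∧
        TorusCritical.IsCriticalPoint
          (TorusCritical.shapeFunctional (TorusCritical.lagrangeFunction n α β) p)
          (TorusCritical.torus a r)) ∧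
    (3 ≤ n → a ^ 2 ≠ 2 * r ^ 2 →
      ∀ (α₀ : ℕ → ℝ) (β₀ : ℕ → ℕ → ℝ), ∃ (α : ℕ → ℝ) (β : ℕ → ℕ → ℝ) (p : ℝ),
        (∀ k, k ≠ 0 → k ≠ 2 → α k = α₀ k) ∧ (∀ m k, m ≠ 1 → β m k = β₀ m k) ∧
        TorusCritical.IsCriticalPoint
          (TorusCritical.shapeFunctional (TorusCritical.lagrangeFunction n α β) p)
          (TorusCritical.torus a r)) := by
  refine ⟨fun hn hn2 hn3 c => ?_, fun hn hne α₀ β₀ =>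
    TorusCritical.exists_isCriticalPoint_of_ne hr har hn hne α₀ β₀⟩
  by_cases h1 : n = 1
  · subst h1
    exact TorusCritical.exists_isCriticalPoint_one hr har c
  by_cases hne : a ^ 2 = 2 * r ^ 2
  · have : n ≠ 3 := fun h => hn3 h hne
    exact TorusCritical.exists_isCriticalPoint_of_eq hr har (by omega) hne c
  -- Of the constant sequence `c` only the entry at `n` matters; it is kept because `n` is neither
  -- `0` nor `2`.
  · obtain ⟨α, β, p, hα, -, hcrit⟩ :=
      TorusCritical.exists_isCriticalPoint_of_ne hr har (by omega : 3 ≤ n) hne (fun _ => c)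
        fun _ _ => 0
    exact ⟨α, β, p, hα n (by omega) hn2, hcrit⟩
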